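/- Let $n$ be a natural number, let $J_n$ be the antidiagonal $n\times n$ matrix with all antidiagonal entries $1$, and let $E_D$ be the antidiagonal $2n\times 2n$ matrix with all antidiagonal entries $1$, $E_B$ the antidiagonal $(2n+1)\times(2n+1)$ matrix with all antidiagonal entries $1$ except the middle one, which is $2$, and $E_C=\begin{pmatrix}0&-J_n\\ J_n&0\end{pmatrix}$. Let $G$ be one of the complex groups $$\mathrm{SO}_{2n}=\{g\in \mathrm{SL}_{2n}: (g^t)^{-1}=E_DgE_D^{-1}\},\quad \mathrm{SO}_{2n+1}=\{g\in \mathrm{SL}_{2n+1}: (g^t)^{-1}=E_BgE_B^{-1}\},\quad \mathrm{Sp}_{2n}=\{g\in \mathrm{SL}_{2n}: (g^t)^{-1}=E_CgE_C^{-1}\},$$ let $V$ be its defining representation and $\mathfrak g\subset \mathrm{End}(V)$ its Lie algebra. Let $T\subset G$ be the maximal torus of the matrices $\mathbf t=\mathrm{diag}(t_1,\dots,t_n,t_n^{-1},\dots,t_1^{-1})$ (for $\mathrm{SO}_{2n}$, $\mathrm{Sp}_{2n}$), respectively $\mathbf t=\mathrm{diag}(t_1,\dots,t_n,1,t_n^{-1},\dots,t_1^{-1})$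 (for $\mathrm{SO}_{2n+1}$), with $t_i\in\mathbb C^*$; let $\mathfrak t$ be its Lie algebra and $W=N_G(T)/T$ the Weyl group. Let $\theta:G\to\mathfrak g$ be the Springer morphism of $V$: $\theta(g)$ is the projection of $g\in\mathrm{End}(V)=\mathfrak g\oplus\mathfrak g^\perp$ to $\mathfrak g$, where $\mathfrak g^\perp$ is the orthogonal complement for the form $\langle A,B\rangle=\mathrm{tr}(AB)$; it maps $T$ to $\mathfrak t$. Let $\mathrm{Rep}^{\mathbb C}(G)$ be the complexified ring of finite-dimensional rational representations of $G$, each virtual representation being identified with the restriction of its character to $T$. Let $\mathrm{Rep}^{\mathbb C}_{\mathrm{poly}}(G)$ be the set of the elements of $\mathrm{Rep}^{\mathbb C}(G)$ that are of the form $p\circ\theta|_T$ for a $W$-invariant polynomial function $p$ on $\mathfrak t$. Let $f:T\to\mathbb C$ be a regular map. Then $f\in \mathrm{Rep}^{\mathbb C}_{\mathrm{poly}}(G)$ if and only if the following is satisfied. (a) If $G=\mathrm{Sp}_{2n}$ or $G=\mathrm{SO}_{2n+1}$: there is a symmetric polynomial $P\in\mathbb C[x_1,\dots,x_n]$ such that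 for all $\mathbf t\in T$ $$f(\mathbf t)=P\left(\Big(\tfrac{t_1-t_1^{-1}}2\Big)^2,\dots,\Big(\tfrac{t_n-t_n^{-1}}2\Big)^2\right).$$ (b) If $G=\mathrm{SO}_{2n}$: there are symmetric polynomials $P,Q\in\mathbb C[x_1,\dots,x_n]$ such that for all $\mathbf t\in T$ $$f(\mathbf t)=P\left(\Big(\tfrac{t_1-t_1^{-1}}2\Big)^2,\dots,\Big(\tfrac{t_n-t_n^{-1}}2\Big)^2\right)+\left(\prod_{i=1}^n\tfrac{t_i-t_i^{-1}}2\right)Q\left(\Big(\tfrac{t_1-t_1^{-1}}2\Big)^2,\dots,\Big(\tfrac{t_n-t_n^{-1}}2\Big)^2\right).$$ -/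

import Mathlib

namespace ClassicalSpringer

open Matrix

noncomputable section

section General

variable {ι : Type} [Fintype ι] [DecidableEq ι]

/-- The value at the matrix `A` of a polynomial `p` in the matrix entries. -/
def polyEval (p : MvPolynomial (ι × ι) ℂ) (A : Matrix ι ι ℂ) : ℂ :=
  MvPolynomial.eval (fun ij => A ij.1 ij.2) p

/-- The group of matrices of determinant one that preserve the bilinear form with (invertible)
Gram matrix `E`; see `mem_formGroup_iff` for the form of the condition used in the literature. -/
def formGroup (E : Matrix ι ι ℂ) : Subgroup (SpecialLinearGroup ι ℂ) where
  carrier := {g | (g : Matrix ι ι ℂ)ᵀ * E * (g : Matrix ι ι ℂ) = E}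
  one_mem' := by simp
  mul_mem' {a b} ha hb := by
    change (a : Matrix ι ι ℂ)ᵀ * E * (a : Matrix ι ι ℂ) = E at ha
    change (b : Matrix ι ι ℂ)ᵀ * E * (b : Matrix ι ι ℂ) = E at hb
    change ((a : Matrix ι ι ℂ) * (b : Matrix ι ι ℂ))ᵀ * E *
      ((a : Matrix ι ι ℂ) * (b : Matrix ι ι ℂ)) = E
    rw [transpose_mul]
    calc (b : Matrix ι ι ℂ)ᵀ * (a : Matrix ι ι ℂ)ᵀ * E * ((a : Matrix ι ι ℂ) * (b : Matrix ι ι ℂ))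
        = (b : Matrix ι ι ℂ)ᵀ * ((a : Matrix ι ι ℂ)ᵀ * E * (a : Matrix ι ι ℂ))
            * (b : Matrix ι ι ℂ) := by simp only [Matrix.mul_assoc]
      _ = E := by rw [ha, hb]
  inv_mem' {a} ha := by
    change (a : Matrix ι ι ℂ)ᵀ * E * (a : Matrix ι ι ℂ) = E at ha
    change ((a⁻¹ : SpecialLinearGroup ι ℂ) : Matrix ι ι ℂ)ᵀ * E *
      ((a⁻¹ : SpecialLinearGroup ι ℂ) : Matrix ι ι ℂ) = E
    have h : (a : Matrix ι ι ℂ) * ((a⁻¹ : SpecialLinearGroup ι ℂ) : Matrix ι ι ℂ) = 1 :=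
      congrArg (fun g : SpecialLinearGroup ι ℂ => (g : Matrix ι ι ℂ)) (mul_inv_cancel a)
    have h' : ((a⁻¹ : SpecialLinearGroup ι ℂ) : Matrix ι ι ℂ)ᵀ * (a : Matrix ι ι ℂ)ᵀ = 1 := by
      rw [← transpose_mul, h, transpose_one]
    generalize ((a⁻¹ : SpecialLinearGroup ι ℂ) : Matrix ι ι ℂ) = b at *
    calc bᵀ * E * b = bᵀ * ((a : Matrix ι ι ℂ)ᵀ * E * (a : Matrix ι ι ℂ)) * b := by rw [ha]
      _ = (bᵀ * (a : Matrix ι ι ℂ)ᵀ) * E * ((a : Matrix ι ι ℂ) * b) := by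
          simp only [Matrix.mul_assoc]
      _ = E := by rw [h, h', Matrix.one_mul, Matrix.mul_one]

theorem mem_formGroup_iff {E : Matrix ι ι ℂ} (hE : IsUnit E.det)
    (g : SpecialLinearGroup ι ℂ) :
    g ∈ formGroup E ↔ ((g : Matrix ι ι ℂ)ᵀ)⁻¹ = E * (g : Matrix ι ι ℂ) * E⁻¹ := by
  have hg : IsUnit ((g : Matrix ι ι ℂ)ᵀ).det := by simp
  change (g : Matrix ι ι ℂ)ᵀ * E * (g : Matrix ι ι ℂ) = E ↔ _
  constructor
  · intro h
    apply Matrix.inv_eq_right_inv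
    rw [← Matrix.mul_assoc, ← Matrix.mul_assoc, h, Matrix.mul_nonsing_inv _ hE]
  · intro h
    have h2 := congrArg (fun M => (g : Matrix ι ι ℂ)ᵀ * M * E) h
    simp only [Matrix.mul_nonsing_inv _ hg, Matrix.one_mul] at h2
    rw [← Matrix.mul_assoc, Matrix.mul_assoc _ E⁻¹ E, Matrix.nonsing_inv_mul _ hE,
      Matrix.mul_one, ← Matrix.mul_assoc] at h2
    exact h2.symm

/-- The underlying matrix of an element of `formGroup E` (its action on the defining
representation). -/
def toMat {E : Matrix ι ι ℂ} (g : formGroup E) : Matrix ι ι ℂ :=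
  ((g : SpecialLinearGroup ι ℂ) : Matrix ι ι ℂ)

/-- A regular function on the closed subvariety of matrices parametrized by `c : X → Matrix`:
the restriction of a polynomial in the matrix entries. -/
def IsRegular {X : Type} (c : X → Matrix ι ι ℂ) (f : X → ℂ) : Prop :=
  ∃ p : MvPolynomial (ι × ι) ℂ, ∀ x, f x = polyEval p (c x)

/-- A representation of the linear algebraic group `formGroup E` is rational if all its matrix
coefficients are regular functions. -/
def IsRational {E : Matrix ι ι ℂ} {V : Type} [AddCommGroup V] [Module ℂ V]
    (ρ : Representation ℂ (formGroup E) V) : Prop :=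
  ∀ (φ : Module.Dual ℂ V) (v : V), IsRegular toMat (fun g => φ (ρ g v))

/-- The complexified representation ring of `G = formGroup E`, each virtual representation being
identified with the restriction of its character to the maximal torus `T`: the complex span of the
restricted characters of the finite-dimensional rational representations of `G`. -/
def repC (E : Matrix ι ι ℂ) (T : Subgroup (formGroup E)) : Submodule ℂ (T → ℂ) :=
  Submodule.span ℂ {χ | ∃ (V : Type) (_ : AddCommGroup V) (_ : Module ℂ V)
    (_ : FiniteDimensional ℂ V) (ρ : Representation ℂ (formGroup E) V),
      IsRational ρ ∧ ∀ t : T, χ t = LinearMap.trace ℂ V (ρ (t : formGroup E))}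

/-- The Lie algebra of `formGroup E`: the matrices `X` with `Xᵀ E + E X = 0`. -/
def lieAlg (E : Matrix ι ι ℂ) : Submodule ℂ (Matrix ι ι ℂ) :=
  skewAdjointMatricesSubmodule E

/-- The orthogonal complement of a space of matrices for the form `⟨A, B⟩ = tr (A B)`. -/
def traceOrth (𝔤 : Submodule ℂ (Matrix ι ι ℂ)) : Submodule ℂ (Matrix ι ι ℂ) where
  carrier := {A | ∀ X ∈ 𝔤, trace (A * X) = 0}
  zero_mem' := by simp
  add_mem' := by
    intro a b ha hb X hX
    rw [Matrix.add_mul, trace_add, ha X hX, hb X hX, add_zero]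
  smul_mem' := by
    intro c a ha X hX
    rw [Matrix.smul_mul, trace_smul, ha X hX, smul_zero]

/-- `E` is the Gram matrix of a nondegenerate symmetric or alternating form. -/
structure IsForm (E : Matrix ι ι ℂ) : Prop where
  isUnit_det : IsUnit E.det
  symm_or_skew : Eᵀ = E ∨ Eᵀ = -E

theorem mem_lieAlg {E : Matrix ι ι ℂ} (X : Matrix ι ι ℂ) :
    X ∈ lieAlg E ↔ Xᵀ * E = -(E * X) := by
  rw [lieAlg, mem_skewAdjointMatricesSubmodule]
  simp [Matrix.IsSkewAdjoint, Matrix.IsAdjointPair]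

theorem IsForm.isCompl {E : Matrix ι ι ℂ} (hE : IsForm E) :
    IsCompl (lieAlg E) (traceOrth (lieAlg E)) := by
  have h1 : E⁻¹ * E = 1 := Matrix.nonsing_inv_mul _ hE.isUnit_det
  have h2 : E * E⁻¹ = 1 := Matrix.mul_nonsing_inv _ hE.isUnit_det
  have key : ∀ A : Matrix ι ι ℂ, A - E⁻¹ * Aᵀ * E ∈ lieAlg E := by
    intro A
    rw [mem_lieAlg]
    have h3 : (E⁻¹ * Aᵀ * E)ᵀ * E = E * A := by
      have h4 : Eᵀ * E⁻¹ᵀ = 1 := by rw [← transpose_mul, h1, transpose_one]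
      simp only [transpose_mul, transpose_transpose]
      rcases hE.symm_or_skew with h | h
      · rw [h] at h4 ⊢
        have : E⁻¹ᵀ = E⁻¹ := (Matrix.inv_eq_right_inv h4).symm
        rw [this, Matrix.mul_assoc, Matrix.mul_assoc A, h1, Matrix.mul_one]
      · rw [h] at h4 ⊢
        have : E⁻¹ᵀ = -E⁻¹ := by
          have h5 : E * (-E⁻¹ᵀ) = 1 := by rw [Matrix.mul_neg, ← Matrix.neg_mul, h4]
          rw [← neg_eq_iff_eq_neg]
          exact (Matrix.inv_eq_right_inv h5).symm
        rw [this, Matrix.mul_assoc, Matrix.mul_assoc A, Matrix.neg_mul, Matrix.neg_mul, h1,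
          Matrix.mul_neg, Matrix.mul_one, Matrix.mul_neg, neg_neg]
    rw [transpose_sub, Matrix.sub_mul, h3, Matrix.mul_sub, Matrix.mul_assoc, ← Matrix.mul_assoc E,
      h2, Matrix.one_mul, neg_sub]
  have key2 : ∀ A : Matrix ι ι ℂ, A + E⁻¹ * Aᵀ * E ∈ traceOrth (lieAlg E) := by
    intro A X hX
    rw [mem_lieAlg] at hX
    have hX' : E * X * E⁻¹ = -Xᵀ := by
      rw [← neg_eq_iff_eq_neg, ← Matrix.neg_mul, ← hX, Matrix.mul_assoc, h2, Matrix.mul_one]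
    rw [Matrix.add_mul, trace_add, Matrix.mul_assoc, Matrix.mul_assoc, trace_mul_comm E⁻¹,
      Matrix.mul_assoc, hX', Matrix.mul_neg, trace_neg, ← transpose_mul, trace_transpose,
      trace_mul_comm X, add_neg_cancel]
  refine ⟨?_, ?_⟩
  · rw [Submodule.disjoint_def]
    intro X hX hX'
    rw [mem_lieAlg] at hX
    have hX2 : E⁻¹ * Xᵀ * E = -X := by
      rw [Matrix.mul_assoc, hX, Matrix.mul_neg, ← Matrix.mul_assoc, h1, Matrix.one_mul]
    have h0 : ∀ A : Matrix ι ι ℂ, trace (X * A) = 0 := by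
      intro A
      have e1 : trace (X * (A - E⁻¹ * Aᵀ * E)) = 0 := hX' _ (key A)
      have e2 : trace (X * (A + E⁻¹ * Aᵀ * E)) = 0 := by
        rw [trace_mul_comm]
        exact key2 A X ((mem_lieAlg X).2 hX)
      rw [Matrix.mul_sub, trace_sub] at e1
      rw [Matrix.mul_add, trace_add] at e2
      linear_combination (e1 + e2) / 2
    ext i j
    have := h0 (Matrix.single j i 1)
    rwa [Matrix.trace_mul_single, MulOpposite.op_one, one_smul] at this
  · rw [codisjoint_iff, eq_top_iff]
    intro A _
    have : A = (1 / 2 : ℂ) • (A - E⁻¹ * Aᵀ * E) + (1 / 2 : ℂ) • (A + E⁻¹ * Aᵀ * E) := by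
      ext i j
      simp only [Matrix.add_apply, Matrix.sub_apply, Matrix.smul_apply, smul_eq_mul]
      ring
    rw [this]
    exact Submodule.add_mem_sup (Submodule.smul_mem _ _ (key A)) (Submodule.smul_mem _ _ (key2 A))

/-- The Springer morphism `θ : G → 𝔤` of `G = formGroup E` for its defining representation: the
projection of `g ∈ End(V) = 𝔤 ⊕ 𝔤^⊥` to `𝔤`, with `𝔤^⊥` taken for the trace form. -/
def springer {E : Matrix ι ι ℂ} (hE : IsForm E) (g : formGroup E) : Matrix ι ι ℂ :=
  (Submodule.projectionOnto _ _ hE.isCompl (toMat g) : lieAlg E)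

/-- The polynomial representation ring of `G = formGroup E` with respect to the defining
representation, where `T` is a maximal torus with Lie algebra `𝔱`: the elements of the complexified
representation ring of `G` whose restriction to `T` is the pullback along `θ : T → 𝔱` of a
polynomial function on `𝔱` that is invariant under the Weyl group `N_G(T) / T`. A polynomial
function on the linear subspace `𝔱` is given as the restriction of a polynomial on all matrices. -/
def repPoly {E : Matrix ι ι ℂ} (hE : IsForm E) (T : Subgroup (formGroup E))
    (𝔱 : Submodule ℂ (Matrix ι ι ℂ)) : Set (T → ℂ) :=
  {f | f ∈ repC E T ∧ ∃ p : MvPolynomial (ι × ι) ℂ,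
    (∀ w ∈ Subgroup.normalizer (T : Set (formGroup E)), ∀ x ∈ 𝔱,
      polyEval p (toMat w * x * toMat (w⁻¹)) = polyEval p x) ∧
    ∀ t : T, f t = polyEval p (springer hE (t : formGroup E))}

/-- A homomorphism from the standard torus to `formGroup E` given by diagonal matrices. -/
def diagHom {n : ℕ} (E : Matrix ι ι ℂ) (d : (Fin n → ℂˣ) →* (ι → ℂ))
    (hdet : ∀ t, ∏ i, d t i = 1) (hE : ∀ t i j, d t i * E i j * d t j = E i j) :
    (Fin n → ℂˣ) →* formGroup E where
  toFun t := ⟨⟨diagonal (d t), by rw [det_diagonal, hdet]⟩, by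
    change (diagonal (d t))ᵀ * E * diagonal (d t) = E
    ext i j
    rw [diagonal_transpose, mul_diagonal, diagonal_mul, hE]⟩
  map_one' := by
    apply Subtype.ext
    apply Subtype.ext
    simp
  map_mul' s t := by
    apply Subtype.ext
    apply Subtype.ext
    change diagonal (d (s * t)) = diagonal (d s) * diagonal (d t)
    rw [diagonal_mul_diagonal, map_mul]
    rfl

end General

/-- The antidiagonal matrix with all antidiagonal entries one. -/
def antidiag (n : ℕ) : Matrix (Fin n) (Fin n) ℂ :=
  Matrix.of fun i j => if j = Fin.rev i then 1 else 0

theorem antidiag_mul_self (n : ℕ) : antidiag n * antidiag n = 1 := by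
  ext i j
  rw [Matrix.mul_apply, Finset.sum_eq_single (Fin.rev i)]
  · simp [antidiag, Matrix.one_apply, eq_comm (a := i) (b := j)]
  · intro k _ hk
    simp [antidiag, hk]
  · simp

theorem antidiag_transpose (n : ℕ) : (antidiag n)ᵀ = antidiag n := by
  ext i j
  simp only [antidiag, transpose_apply, of_apply]
  congr 1
  rw [eq_iff_iff, ← Fin.rev_eq_iff, eq_comm]

/-! Square matrices of size `2n` are indexed by `Fin n ⊕ Fin n`, those of size `2n + 1` by
`Fin n ⊕ (Unit ⊕ Fin n)`, in the evident order. -/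

/-- The `2n × 2n` antidiagonal matrix with all antidiagonal entries one. -/
def formD (n : ℕ) : Matrix (Fin n ⊕ Fin n) (Fin n ⊕ Fin n) ℂ :=
  fromBlocks 0 (antidiag n) (antidiag n) 0

/-- The alternating form with blocks `0, -J; J, 0`. -/
def formC (n : ℕ) : Matrix (Fin n ⊕ Fin n) (Fin n ⊕ Fin n) ℂ :=
  fromBlocks 0 (-antidiag n) (antidiag n) 0

/-- The `(2n+1) × (2n+1)` antidiagonal matrix with all antidiagonal entries one, except the middle
one, which is two. -/
def formB (n : ℕ) : Matrix (Fin n ⊕ (Unit ⊕ Fin n)) (Fin n ⊕ (Unit ⊕ Fin n)) ℂ :=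
  fromBlocks 0 (fromCols 0 (antidiag n)) (fromRows 0 (antidiag n))
    (fromBlocks (diagonal fun _ => 2) 0 0 0)

theorem isForm_formD (n : ℕ) : IsForm (formD n) where
  isUnit_det := by
    apply Matrix.isUnit_det_of_left_inverse (B := formD n)
    simp [formD, fromBlocks_multiply, antidiag_mul_self]
  symm_or_skew := Or.inl (by simp [formD, fromBlocks_transpose, antidiag_transpose])

theorem isForm_formC (n : ℕ) : IsForm (formC n) where
  isUnit_det := by
    apply Matrix.isUnit_det_of_left_inverse (B := -formC n)
    simp [formC, fromBlocks_multiply, antidiag_mul_self, fromBlocks_neg]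
  symm_or_skew := Or.inr (by
    simp [formC, fromBlocks_transpose, antidiag_transpose, fromBlocks_neg])

theorem isForm_formB (n : ℕ) : IsForm (formB n) where
  isUnit_det := by
    apply Matrix.isUnit_det_of_left_inverse
      (B := fromBlocks 0 (fromCols 0 (antidiag n)) (fromRows 0 (antidiag n))
        (fromBlocks (diagonal fun _ => 1 / 2) 0 0 0))
    rw [formB, fromBlocks_multiply]
    simp only [fromCols_mul_fromRows, fromRows_mul_fromCols, antidiag_mul_self, zero_mul,
      mul_zero, Matrix.zero_mul, Matrix.mul_zero, zero_add, fromCols_mul_fromBlocks,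
      fromBlocks_mul_fromRows, fromBlocks_multiply, diagonal_mul_diagonal, add_zero]
    ext (i | i | i) (j | j | j) <;> simp [Matrix.one_apply]
  symm_or_skew := Or.inl (by
    simp [formB, fromBlocks_transpose, antidiag_transpose, transpose_fromCols,
      transpose_fromRows])

/-- `(t_1, …, t_n, t_n⁻¹, …, t_1⁻¹)`. -/
def entriesEven (n : ℕ) : (Fin n → ℂˣ) →* (Fin n ⊕ Fin n → ℂ) where
  toFun t := Sum.elim (fun i => (t i : ℂ)) (fun i => (t (Fin.rev i) : ℂ)⁻¹)
  map_one' := by ext (i | i) <;> simp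
  map_mul' s t := by ext (i | i) <;> simp [mul_comm]

/-- `(t_1, …, t_n, 1, t_n⁻¹, …, t_1⁻¹)`. -/
def entriesOdd (n : ℕ) : (Fin n → ℂˣ) →* (Fin n ⊕ (Unit ⊕ Fin n) → ℂ) where
  toFun t := Sum.elim (fun i => (t i : ℂ))
    (Sum.elim (fun _ => 1) (fun i => (t (Fin.rev i) : ℂ)⁻¹))
  map_one' := by ext (i | i | i) <;> simp
  map_mul' s t := by ext (i | i | i) <;> simp [mul_comm]

theorem prod_rev_inv {n : ℕ} (t : Fin n → ℂˣ) :
    (∏ i, (t i : ℂ)) * ∏ i, (t (Fin.rev i) : ℂ)⁻¹ = 1 := by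
  rw [Fintype.prod_equiv Fin.revPerm (fun i => (t (Fin.rev i) : ℂ)⁻¹) (fun i => (t i : ℂ)⁻¹)
    (fun i => rfl), ← Finset.prod_mul_distrib]
  simp

theorem entriesEven_prod {n : ℕ} (t : Fin n → ℂˣ) : ∏ i, entriesEven n t i = 1 := by
  simpa [entriesEven, Fintype.prod_sum_type] using prod_rev_inv t

theorem entriesOdd_prod {n : ℕ} (t : Fin n → ℂˣ) : ∏ i, entriesOdd n t i = 1 := by
  simpa [entriesOdd, Fintype.prod_sum_type] using prod_rev_inv t

/-- `t ↦ diag (t_1, …, t_n, t_n⁻¹, …, t_1⁻¹)` in `SO_{2n}`. -/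
def torusD (n : ℕ) : (Fin n → ℂˣ) →* formGroup (formD n) :=
  diagHom (formD n) (entriesEven n) entriesEven_prod (by
    intro t i j
    rcases i with i | i <;> rcases j with j | j <;> simp [entriesEven, formD, antidiag]
    · by_cases h : j = Fin.rev i
      · subst h; simp
      · simp [h]
    · by_cases h : j = Fin.rev i
      · subst h; simp
      · simp [h])

/-- `t ↦ diag (t_1, …, t_n, t_n⁻¹, …, t_1⁻¹)` in `Sp_{2n}`. -/
def torusC (n : ℕ) : (Fin n → ℂˣ) →* formGroup (formC n) :=
  diagHom (formC n) (entriesEven n) entriesEven_prod (by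
    intro t i j
    rcases i with i | i <;> rcases j with j | j <;> simp [entriesEven, formC, antidiag]
    · by_cases h : j = Fin.rev i
      · subst h; simp
      · simp [h]
    · by_cases h : j = Fin.rev i
      · subst h; simp
      · simp [h])

/-- `t ↦ diag (t_1, …, t_n, 1, t_n⁻¹, …, t_1⁻¹)` in `SO_{2n+1}`. -/
def torusB (n : ℕ) : (Fin n → ℂˣ) →* formGroup (formB n) :=
  diagHom (formB n) (entriesOdd n) entriesOdd_prod (by
    intro t i j
    rcases i with i | i | i <;> rcases j with j | j | j <;> simp [entriesOdd, formB, antidiag]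
    · by_cases h : j = Fin.rev i
      · subst h; simp
      · simp [h]
    · by_cases h : j = Fin.rev i
      · subst h; simp
      · simp [h])

/-- The diagonal matrices `diag (x_1, …, x_n, -x_n, …, -x_1)`: the Lie algebra of the maximal torus
of `SO_{2n}` and of `Sp_{2n}`. -/
def cartanEven (n : ℕ) : Submodule ℂ (Matrix (Fin n ⊕ Fin n) (Fin n ⊕ Fin n) ℂ) where
  carrier := {X | ∃ x : Fin n → ℂ, X = diagonal (Sum.elim x (fun i => -x (Fin.rev i)))}
  zero_mem' := ⟨0, by ext (i | i) (j | j) <;> simp [diagonal_apply]⟩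
  add_mem' := by
    rintro _ _ ⟨x, rfl⟩ ⟨y, rfl⟩
    refine ⟨x + y, ?_⟩
    rw [diagonal_add]
    congr 1
    ext (i | i) <;> simp [add_comm]
  smul_mem' := by
    rintro c _ ⟨x, rfl⟩
    refine ⟨c • x, ?_⟩
    rw [← diagonal_smul]
    congr 1
    ext (i | i) <;> simp

/-- The diagonal matrices `diag (x_1, …, x_n, 0, -x_n, …, -x_1)`: the Lie algebra of the maximal
torus of `SO_{2n+1}`. -/
def cartanOdd (n : ℕ) :
    Submodule ℂ (Matrix (Fin n ⊕ (Unit ⊕ Fin n)) (Fin n ⊕ (Unit ⊕ Fin n)) ℂ) where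
  carrier := {X | ∃ x : Fin n → ℂ,
    X = diagonal (Sum.elim x (Sum.elim (fun _ => 0) (fun i => -x (Fin.rev i))))}
  zero_mem' := ⟨0, by ext (i | i | i) (j | j | j) <;> simp [diagonal_apply]⟩
  add_mem' := by
    rintro _ _ ⟨x, rfl⟩ ⟨y, rfl⟩
    refine ⟨x + y, ?_⟩
    rw [diagonal_add]
    congr 1
    ext (i | i | i) <;> simp [add_comm]
  smul_mem' := by
    rintro c _ ⟨x, rfl⟩
    refine ⟨c • x, ?_⟩
    rw [← diagonal_smul]
    congr 1
    ext (i | i | i) <;> simp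

/-- The coordinate `(t_i - t_i⁻¹) / 2`. -/
def halfDiff {n : ℕ} (t : Fin n → ℂˣ) (i : Fin n) : ℂ := ((t i : ℂ) - (t i : ℂ)⁻¹) / 2

end

end ClassicalSpringer

namespace ClassicalSpringer

open Matrix

noncomputable section

/-! ### Regular functions form a ring. -/

section Regular

variable {ι : Type} {X : Type} {c : X → Matrix ι ι ℂ}

/-! The projection to the Lie algebra is `A ↦ (A - E⁻¹ Aᵀ E) / 2`, so `θ` sends a torus element to
the point of the Cartan subalgebra with coordinates `xᵢ = (tᵢ - tᵢ⁻¹) / 2`. Everything is then about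
polynomials in `x`.

Necessity. A Weyl-invariant polynomial is tested on permutations and sign changes of the `xᵢ`,
realized by monomial matrices in the group (`exists_polynomial_of_mem_repPoly`). In types B and C
each sign changes alone, so all exponents are even. In type D signs change in pairs, so the
exponents within one monomial share a parity; odd parity splits off the factor `∏ xᵢ`. Averaging
over permutations makes `P` and `Q` symmetric.

Sufficiency. The point is that the given function is a combination of characters. It is first
extended from the Cartan subalgebra to a conjugation-invariant function on all matrices: the traces
`tr (X ^ (2k))` give the power sums of the `xᵢ²`, hence all symmetric polynomials in them, and in
type D the Pfaffian of `E X` gives `∏ xᵢ`. Such a function is a combination of values `H(X, …, X)`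
of invariant multilinear forms. Since `θ` is the restriction of a linear equivariant map, `H(θ(g),
…, θ(g))` is again an invariant form evaluated at `(g, …, g)`, that is, the trace of `g M` on a
tensor power of `V` for some `M` commuting with `G` (`diagonal_form_mem_repC`). On each generalized
eigenspace of `M`, a subrepresentation, this trace is the eigenvalue times the character
(`trace_commuting_mem_repC`). Complete reducibility is not needed. -/

theorem IsRegular.const (z : ℂ) : IsRegular c (fun _ => z) :=
  ⟨MvPolynomial.C z, fun x => by simp [polyEval]⟩

theorem IsRegular.entry (i j : ι) : IsRegular c (fun x => c x i j) :=
  ⟨MvPolynomial.X (i, j), fun x => by simp [polyEval]⟩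

theorem IsRegular.add {f g : X → ℂ} (hf : IsRegular c f) (hg : IsRegular c g) :
    IsRegular c (fun x => f x + g x) := by
  obtain ⟨p, hp⟩ := hf
  obtain ⟨q, hq⟩ := hg
  exact ⟨p + q, fun x => by simp [hp, hq, polyEval]⟩

theorem IsRegular.mul {f g : X → ℂ} (hf : IsRegular c f) (hg : IsRegular c g) :
    IsRegular c (fun x => f x * g x) := by
  obtain ⟨p, hp⟩ := hf
  obtain ⟨q, hq⟩ := hg
  exact ⟨p * q, fun x => by simp [hp, hq, polyEval]⟩

theorem IsRegular.sum {α : Type} (s : Finset α) {f : α → X → ℂ} (hf : ∀ a, IsRegular c (f a)) :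
    IsRegular c (fun x => ∑ a ∈ s, f a x) := by
  choose p hp using hf
  exact ⟨∑ a ∈ s, p a, fun x => by simp [hp, polyEval]⟩

theorem IsRegular.prod {α : Type} (s : Finset α) {f : α → X → ℂ} (hf : ∀ a, IsRegular c (f a)) :
    IsRegular c (fun x => ∏ a ∈ s, f a x) := by
  choose p hp using hf
  exact ⟨∏ a ∈ s, p a, fun x => by simp [hp, polyEval]⟩

end Regular

/-! ### Kronecker powers and multilinear forms on matrices. -/

section Kronecker

/-- The Kronecker power of a matrix over the index set `α`. -/
def kroneckerPow {ι : Type} (α : Type) [Fintype α] (A : Matrix ι ι ℂ) : Matrix (α → ι) (α → ι) ℂ :=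
  Matrix.of fun a b => ∏ i, A (a i) (b i)

theorem kroneckerPow_mul {ι : Type} [Fintype ι] (α : Type) [Fintype α] [DecidableEq α] (A B : Matrix ι ι ℂ) :
    kroneckerPow α (A * B) = kroneckerPow α A * kroneckerPow α B := by
  ext a b
  simp only [kroneckerPow, of_apply, Matrix.mul_apply, ← Finset.prod_mul_distrib]
  rw [Finset.prod_univ_sum]
  simp

theorem kroneckerPow_one {ι : Type} [DecidableEq ι] (α : Type) [Fintype α] [DecidableEq α] :
    kroneckerPow α (1 : Matrix ι ι ℂ) = 1 := by
  ext a b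
  simp only [kroneckerPow, of_apply, Matrix.one_apply, Finset.prod_ite_zero, Finset.prod_const_one,
    Finset.mem_univ, true_imp_iff, funext_iff]

/-- When all `A i` coincide, the products are entries of a Kronecker power, so the double sum is the
trace of that power times a fixed matrix. -/
theorem multilinear_expand {ι : Type} [Fintype ι] {α : Type} [Fintype α] [DecidableEq α]
    [DecidableEq ι] (H : MultilinearMap ℂ (fun _ : α => Matrix ι ι ℂ) ℂ) (A : α → Matrix ι ι ℂ) :
    H A = ∑ a : α → ι, ∑ b : α → ι, (∏ i, A i (a i) (b i)) *
      H (fun i => Matrix.single (a i) (b i) 1) := by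
  have h : A = fun i => ∑ p : ι × ι, A i p.1 p.2 • Matrix.single p.1 p.2 (1 : ℂ) := by
    funext i
    conv_lhs => rw [Matrix.matrix_eq_sum_single (A i)]
    rw [Fintype.sum_prod_type]
    simp
  conv_lhs => rw [h]
  rw [H.map_sum, ← Fintype.sum_prod_type', ← (Equiv.arrowProdEquivProdArrow α (fun _ => ι) (fun _ => ι)).sum_comp]
  refine Finset.sum_congr rfl fun r _ => ?_
  rw [H.map_smul_univ (fun i => A i (r i).1 (r i).2)]
  rfl

end Kronecker

/-! ### Characters from operators commuting with a representation. -/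

section General

variable {ι : Type} [Fintype ι] [DecidableEq ι] {E : Matrix ι ι ℂ}

theorem toMat_mul (g h : formGroup E) : toMat (g * h) = toMat g * toMat h := by
  simp [toMat]

theorem toMat_one : toMat (1 : formGroup E) = 1 := by
  simp [toMat]

theorem toMat_mul_inv (g : formGroup E) : toMat g * toMat g⁻¹ = 1 := by
  rw [← toMat_mul, mul_inv_cancel, toMat_one]

theorem toMat_inv_mul (g : formGroup E) : toMat g⁻¹ * toMat g = 1 := by
  rw [← toMat_mul, inv_mul_cancel, toMat_one]

theorem transpose_toMat_mul_mul (g : formGroup E) : (toMat g)ᵀ * E * toMat g = E := g.2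

theorem det_toMat (g : formGroup E) : (toMat g).det = 1 := g.1.2

theorem toMat_injective : Function.Injective (toMat : formGroup E → Matrix ι ι ℂ) :=
  fun _ _ h => Subtype.ext (Subtype.ext h)

/-- The restriction of a representation to a stable subspace. -/
def restrictRep {G V : Type} [Group G] [AddCommGroup V] [Module ℂ V] (ρ : Representation ℂ G V)
    (W : Submodule ℂ V) (hW : ∀ g, Set.MapsTo (ρ g) W W) : Representation ℂ G W where
  toFun g := (ρ g).restrict (hW g)
  map_one' := by ext; simp [LinearMap.restrict_apply]
  map_mul' g h := by
    ext v
    change ρ (g * h) v = ρ g (ρ h v)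
    rw [map_mul]
    rfl

/-- Functionals on the subspace extend to `V`, so its matrix coefficients are among those of `ρ`. -/
theorem IsRational.restrictRep {V : Type} [AddCommGroup V] [Module ℂ V]
    {ρ : Representation ℂ (formGroup E) V} (hρ : IsRational ρ) (W : Submodule ℂ V)
    (hW : ∀ g, Set.MapsTo (ρ g) W W) : IsRational (restrictRep ρ W hW) := by
  intro φ v
  obtain ⟨ψ, hψ⟩ := LinearMap.exists_extend φ
  have h : (fun g => φ (ClassicalSpringer.restrictRep ρ W hW g v)) = fun g => ψ (ρ g v) := by
    funext g
    rw [← hψ]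
    rfl
  rw [h]
  exact hρ ψ v

/-- The trace of `c ∘ ρ(t)`, where `c` commutes with the rational representation `ρ`, lies in the
complexified representation ring. -/
theorem trace_commuting_mem_repC {T : Subgroup (formGroup E)} {V : Type} [AddCommGroup V]
    [Module ℂ V] [FiniteDimensional ℂ V] {ρ : Representation ℂ (formGroup E) V}
    (hρ : IsRational ρ) (c : Module.End ℂ V) (hc : ∀ g, Commute c (ρ g)) :
    (fun t : T => LinearMap.trace ℂ V (ρ t ∘ₗ c)) ∈ repC E T := by
  classical
  -- The generalized eigenspaces of `c` are subrepresentations and decompose `V`. On each, `c - μ`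
  -- is nilpotent and commutes with `ρ t`, so it contributes no trace and `c` may be replaced by
  -- `μ`.
  have hmap : ∀ (μ : ℂ) (g : formGroup E),
      Set.MapsTo (ρ g) (c.maxGenEigenspace μ) (c.maxGenEigenspace μ) :=
    fun μ g => c.mapsTo_maxGenEigenspace_of_comm (hc g) μ
  have hind : iSupIndep c.maxGenEigenspace := c.independent_maxGenEigenspace
  have hfin : {μ | c.maxGenEigenspace μ ≠ ⊥}.Finite :=
    WellFoundedGT.finite_ne_bot_of_iSupIndep hind
  have hint := DirectSum.isInternal_submodule_of_iSupIndep_of_iSup_eq_top hind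
    c.iSup_maxGenEigenspace_eq_top
  have hmem : ∀ μ, (fun t : T => LinearMap.trace ℂ _
      (restrictRep ρ (c.maxGenEigenspace μ) (hmap μ) t)) ∈ repC E T := fun μ =>
    Submodule.subset_span ⟨c.maxGenEigenspace μ, inferInstance, inferInstance, inferInstance,
      restrictRep ρ (c.maxGenEigenspace μ) (hmap μ), hρ.restrictRep _ _, fun _ => rfl⟩
  have heq : (fun t : T => LinearMap.trace ℂ V (ρ t ∘ₗ c)) =
      ∑ μ ∈ hfin.toFinset, μ • (fun t : T => LinearMap.trace ℂ _
        (restrictRep ρ (c.maxGenEigenspace μ) (hmap μ) t)) := by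
    funext t
    have hm : ∀ μ, Set.MapsTo (ρ t ∘ₗ c) (c.maxGenEigenspace μ) (c.maxGenEigenspace μ) :=
      fun μ => (hmap μ t).comp (c.mapsTo_maxGenEigenspace_of_comm rfl μ)
    rw [LinearMap.trace_eq_sum_trace_restrict' hint hfin hm, Finset.sum_apply]
    refine Finset.sum_congr rfl fun μ _ => ?_
    rw [Pi.smul_apply, smul_eq_mul]
    have hcμ := c.mapsTo_maxGenEigenspace_of_comm rfl μ
    have hcomm : Commute (restrictRep ρ (c.maxGenEigenspace μ) (hmap μ) t) (c.restrict hcμ) := by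
      ext v
      exact (LinearMap.congr_fun (hc t).eq (v : V)).symm
    rw [← LinearMap.trace_comp_eq_mul_of_commute_of_isNilpotent μ hcomm
      (c.isNilpotent_restrict_maxGenEigenspace_sub_algebraMap μ)]
    rfl
  rw [heq]
  exact Submodule.sum_mem _ fun μ _ => Submodule.smul_mem _ _ (hmem μ)

/-- The tensor power of the defining representation. -/
def tensorRep (E : Matrix ι ι ℂ) (α : Type) [Fintype α] [DecidableEq α] :
    Representation ℂ (formGroup E) ((α → ι) → ℂ) where
  toFun g := Matrix.toLin' (kroneckerPow α (toMat g))
  map_one' := by rw [toMat_one, kroneckerPow_one, Matrix.toLin'_one]; rfl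
  map_mul' g h := by rw [toMat_mul, kroneckerPow_mul, Matrix.toLin'_mul]; rfl

theorem isRational_tensorRep (α : Type) [Fintype α] [DecidableEq α] :
    IsRational (tensorRep E α) := by
  intro φ v
  have h : (fun g => φ (tensorRep E α g v)) = fun g => ∑ a, (∑ b, (∏ i, toMat g (a i) (b i)) * v b) *
      φ (fun j => if a = j then 1 else 0) := by
    funext g
    rw [LinearMap.pi_apply_eq_sum_univ φ]
    rfl
  rw [h]
  exact IsRegular.sum _ fun a => (IsRegular.sum _ fun b =>
    (IsRegular.prod _ fun i => IsRegular.entry _ _).mul (IsRegular.const _)).mul (IsRegular.const _)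

/-- A multilinear form on matrices that is invariant under simultaneous conjugation by
`formGroup E`. -/
def IsConjInvariant (E : Matrix ι ι ℂ) {α : Type}
    (H : MultilinearMap ℂ (fun _ : α => Matrix ι ι ℂ) ℂ) : Prop :=
  ∀ (g : formGroup E) (A : α → Matrix ι ι ℂ), H (fun a => toMat g * A a * toMat g⁻¹) = H A

/-- `H` is the trace against a matrix `M` on the tensor power, and conjugation invariance of `H`
says that `M` commutes with the group. -/
theorem diagonal_form_mem_repC {T : Subgroup (formGroup E)} {α : Type} [Fintype α]
    (H : MultilinearMap ℂ (fun _ : α => Matrix ι ι ℂ) ℂ) (hH : IsConjInvariant E H) :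
    (fun t : T => H (fun _ => toMat (t : formGroup E))) ∈ repC E T := by
  classical
  -- The indices are transposed relative to the matrix units so that the expansion of `H` becomes a
  -- trace of a product.
  set M : Matrix (α → ι) (α → ι) ℂ :=
    Matrix.of fun b a => H (fun i => Matrix.single (a i) (b i) 1) with hM
  have hconj : ∀ g : formGroup E,
      kroneckerPow α (toMat g⁻¹) * M * kroneckerPow α (toMat g) = M := by
    intro g
    ext b a
    have h := hH g (fun i => Matrix.single (a i) (b i) 1)
    rw [multilinear_expand] at h
    simp only [hM, of_apply]
    rw [← h]
    simp only [Matrix.mul_apply, Finset.sum_mul, of_apply]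
    refine Finset.sum_congr rfl fun a' _ => Finset.sum_congr rfl fun b' _ => ?_
    have h2 : ∀ i, (∑ k, (∑ l, toMat g (a' i) l * Matrix.single (a i) (b i) (1 : ℂ) l k) *
        toMat g⁻¹ k (b' i)) = toMat g⁻¹ (b i) (b' i) * toMat g (a' i) (a i) := by
      intro i
      simp [Matrix.single_apply, ite_and, mul_comm]
    simp only [← Finset.sum_mul, h2, Finset.prod_mul_distrib, kroneckerPow, of_apply]
    ring
  have hcomm : ∀ g : formGroup E, Commute (Matrix.toLin' M) (tensorRep E α g) := by
    intro g
    change Matrix.toLin' M ∘ₗ Matrix.toLin' _ = Matrix.toLin' _ ∘ₗ Matrix.toLin' M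
    rw [← Matrix.toLin'_mul, ← Matrix.toLin'_mul]
    congr 1
    conv_rhs => rw [← hconj g]
    rw [Matrix.mul_assoc, ← Matrix.mul_assoc, ← kroneckerPow_mul, toMat_mul_inv, kroneckerPow_one,
      Matrix.one_mul]
  convert trace_commuting_mem_repC (T := T) (isRational_tensorRep (E := E) α) _ hcomm using 2 with t
  change _ = LinearMap.trace ℂ _ (Matrix.toLin' _ ∘ₗ Matrix.toLin' M)
  rw [← Matrix.toLin'_mul, Matrix.trace_toLin'_eq, multilinear_expand]
  rfl

end General

/-! ### The Springer morphism and conjugation-invariant functions. -/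

section General

variable {ι : Type} [Fintype ι] [DecidableEq ι] {E : Matrix ι ι ℂ}

theorem IsForm.inv_mul (hE : IsForm E) : E⁻¹ * E = 1 := Matrix.nonsing_inv_mul _ hE.isUnit_det

theorem IsForm.mul_inv (hE : IsForm E) : E * E⁻¹ = 1 := Matrix.mul_nonsing_inv _ hE.isUnit_det

/-- In the alternating case the two signs cancel, which lets both kinds of form be treated together.
-/
theorem IsForm.transpose_conj (hE : IsForm E) (A : Matrix ι ι ℂ) :
    Eᵀ * A * E⁻¹ᵀ = E * A * E⁻¹ := by
  rcases hE.symm_or_skew with h | h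
  · rw [transpose_nonsing_inv, h]
  · have h' : (-E)⁻¹ = -E⁻¹ := by
      apply Matrix.inv_eq_right_inv
      rw [Matrix.neg_mul, Matrix.mul_neg, neg_neg, hE.mul_inv]
    rw [transpose_nonsing_inv, h, h', Matrix.mul_neg, Matrix.neg_mul, Matrix.neg_mul, neg_neg]

/-- The projection `A ↦ (A - E⁻¹ Aᵀ E) / 2` of all matrices to the Lie algebra of
`formGroup E`. -/
def skewPart (E : Matrix ι ι ℂ) : Matrix ι ι ℂ →ₗ[ℂ] Matrix ι ι ℂ where
  toFun A := (1 / 2 : ℂ) • (A - E⁻¹ * Aᵀ * E)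
  map_add' A B := by
    rw [transpose_add, Matrix.mul_add, Matrix.add_mul, add_sub_add_comm, smul_add]
  map_smul' c A := by
    rw [transpose_smul, Matrix.mul_smul, Matrix.smul_mul, ← smul_sub, smul_comm]
    rfl

theorem skewPart_apply (A : Matrix ι ι ℂ) :
    skewPart E A = (1 / 2 : ℂ) • (A - E⁻¹ * Aᵀ * E) := rfl

theorem skewPart_mem_lieAlg (hE : IsForm E) (A : Matrix ι ι ℂ) : skewPart E A ∈ lieAlg E := by
  refine Submodule.smul_mem _ _ ((mem_lieAlg _).2 ?_)
  have h : (E⁻¹ * Aᵀ * E)ᵀ * E = E * A := by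
    rw [transpose_mul, transpose_mul, transpose_transpose, ← Matrix.mul_assoc, hE.transpose_conj,
      Matrix.mul_assoc, hE.inv_mul, Matrix.mul_one]
  rw [transpose_sub, Matrix.sub_mul, h, Matrix.mul_sub, Matrix.mul_assoc, ← Matrix.mul_assoc E,
    hE.mul_inv, Matrix.one_mul, neg_sub]

/-- Taking adjoints preserves traces and negates the Lie algebra, so the self-adjoint part of `A`
pairs to zero with it. -/
theorem sub_skewPart_mem_traceOrth (hE : IsForm E) (A : Matrix ι ι ℂ) :
    A - skewPart E A ∈ traceOrth (lieAlg E) := by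
  intro X hX
  rw [mem_lieAlg] at hX
  have hX' : E * X * E⁻¹ = -Xᵀ := by
    rw [← neg_eq_iff_eq_neg, ← Matrix.neg_mul, ← hX, Matrix.mul_assoc, hE.mul_inv, Matrix.mul_one]
  have h : trace (E⁻¹ * Aᵀ * E * X) = -trace (A * X) := by
    rw [Matrix.mul_assoc, Matrix.mul_assoc, trace_mul_comm E⁻¹,
      Matrix.mul_assoc, hX', Matrix.mul_neg, trace_neg, ← transpose_mul, trace_transpose,
      trace_mul_comm X]
  rw [skewPart_apply, Matrix.sub_mul, trace_sub, Matrix.smul_mul, trace_smul, Matrix.sub_mul,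
    trace_sub, h, smul_eq_mul]
  ring

theorem springer_eq_skewPart (hE : IsForm E) (g : formGroup E) :
    springer hE g = skewPart E (toMat g) := by
  have h : toMat g = ((⟨skewPart E (toMat g), skewPart_mem_lieAlg hE _⟩ : lieAlg E) : Matrix ι ι ℂ) +
      ((⟨_, sub_skewPart_mem_traceOrth hE (toMat g)⟩ : traceOrth (lieAlg E)) : Matrix ι ι ℂ) := by
    simp
  rw [springer]
  conv_lhs => rw [h]
  rw [map_add, Submodule.projectionOnto_apply_left, Submodule.projectionOnto_apply_right, add_zero]

theorem transpose_toMat_mul (g : formGroup E) : (toMat g)ᵀ * E = E * toMat g⁻¹ := by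
  have h := congrArg (· * toMat g⁻¹) (transpose_toMat_mul_mul g)
  simpa only [Matrix.mul_assoc, toMat_mul_inv, Matrix.mul_one] using h

/-- The adjoint of a group element is its inverse, so taking adjoints commutes with conjugation by
the group. -/
theorem skewPart_conj (hE : IsForm E) (g : formGroup E) (A : Matrix ι ι ℂ) :
    skewPart E (toMat g * A * toMat g⁻¹) = toMat g * skewPart E A * toMat g⁻¹ := by
  have h1 : (toMat g)ᵀ * E = E * toMat g⁻¹ := transpose_toMat_mul g
  have h2 : E⁻¹ * (toMat g⁻¹)ᵀ = toMat g * E⁻¹ := by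
    have h3 := transpose_toMat_mul g⁻¹
    rw [inv_inv] at h3
    have h4 : E⁻¹ * ((toMat g⁻¹)ᵀ * E) * E⁻¹ = E⁻¹ * (E * toMat g) * E⁻¹ := by rw [h3]
    rwa [← Matrix.mul_assoc, Matrix.mul_assoc _ E, hE.mul_inv, Matrix.mul_one, ← Matrix.mul_assoc,
      hE.inv_mul, Matrix.one_mul] at h4
  have h5 : E⁻¹ * (toMat g * A * toMat g⁻¹)ᵀ * E = toMat g * (E⁻¹ * Aᵀ * E) * toMat g⁻¹ := by
    rw [transpose_mul, transpose_mul, ← Matrix.mul_assoc, ← Matrix.mul_assoc, h2,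
      Matrix.mul_assoc _ _ E, h1]
    simp only [Matrix.mul_assoc]
  rw [skewPart_apply, skewPart_apply, h5, Matrix.mul_smul, Matrix.smul_mul, Matrix.mul_sub,
    Matrix.sub_mul]

/-- The functions `X ↦ H(X, …, X)` on matrices, for conjugation-invariant multilinear forms
`H`. -/
def invariantForms (E : Matrix ι ι ℂ) : Set (Matrix ι ι ℂ → ℂ) :=
  {F | ∃ (α : Type) (_ : Fintype α) (H : MultilinearMap ℂ (fun _ : α => Matrix ι ι ℂ) ℂ),
    IsConjInvariant E H ∧ ∀ X, F X = H fun _ => X}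

/-- The algebra generated by the functions `X ↦ H(X, …, X)` on matrices, for conjugation-invariant
multilinear forms `H`. -/
def invariantAlg (E : Matrix ι ι ℂ) : Subalgebra ℂ (Matrix ι ι ℂ → ℂ) :=
  Algebra.adjoin ℂ (invariantForms E)

theorem one_mem_invariantForms : (1 : Matrix ι ι ℂ → ℂ) ∈ invariantForms E :=
  ⟨Empty, inferInstance, MultilinearMap.constOfIsEmpty ℂ _ 1, fun _ _ => rfl, fun _ => rfl⟩

/-- The product form takes its arguments from the disjoint union of the two argument sets. Hence the
generated algebra is a linear span, and membership in `repC`, itself only a span, can be checked on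
forms without multiplying characters. -/
theorem mul_mem_invariantForms {F F' : Matrix ι ι ℂ → ℂ} (hF : F ∈ invariantForms E)
    (hF' : F' ∈ invariantForms E) : F * F' ∈ invariantForms E := by
  obtain ⟨α, _, H, hH, hFH⟩ := hF
  obtain ⟨β, _, K, hK, hFK⟩ := hF'
  refine ⟨α ⊕ β, inferInstance, (LinearMap.mul' ℂ ℂ).compMultilinearMap (H.domCoprod K), ?_, ?_⟩
  · intro g A
    have h1 := hH g (fun a => A (Sum.inl a))
    have h2 := hK g (fun a => A (Sum.inr a))
    simp only [LinearMap.compMultilinearMap_apply, MultilinearMap.domCoprod_apply,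
      LinearMap.mul'_apply, h1, h2]
  · intro X
    simp [hFH, hFK]

theorem mem_span_of_mem_invariantAlg {F : Matrix ι ι ℂ → ℂ} (hF : F ∈ invariantAlg E) :
    F ∈ Submodule.span ℂ (invariantForms E) := by
  have h : F ∈ Subalgebra.toSubmodule (Algebra.adjoin ℂ (invariantForms E)) := hF
  rw [Algebra.adjoin_eq_span] at h
  refine Submodule.span_mono (fun F hF => ?_) h
  exact Submonoid.closure_induction (fun _ h => h) one_mem_invariantForms
    (fun _ _ _ _ => mul_mem_invariantForms) hF

theorem isRegular_of_mem_invariantForms {F : Matrix ι ι ℂ → ℂ} (hF : F ∈ invariantForms E) :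
    IsRegular id F := by
  classical
  obtain ⟨α, _, H, hH, hFH⟩ := hF
  have h : F = fun X : Matrix ι ι ℂ => ∑ a : α → ι, ∑ b : α → ι,
      (∏ i, (id X : Matrix ι ι ℂ) (a i) (b i)) *
      H (fun i => Matrix.single (a i) (b i) 1) := by
    funext X
    rw [hFH, multilinear_expand]
    rfl
  rw [h]
  exact IsRegular.sum _ fun a => IsRegular.sum _ fun b =>
    (IsRegular.prod _ fun i => IsRegular.entry _ _).mul (IsRegular.const _)

theorem isRegular_of_mem_invariantAlg {F : Matrix ι ι ℂ → ℂ} (hF : F ∈ invariantAlg E) :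
    IsRegular id F := by
  refine Algebra.adjoin_induction (fun _ h => isRegular_of_mem_invariantForms h)
    (fun z => IsRegular.const z) (fun _ _ _ _ h h' => h.add h') (fun _ _ _ _ h h' => h.mul h') hF

theorem conj_invariant_of_mem_invariantAlg {F : Matrix ι ι ℂ → ℂ} (hF : F ∈ invariantAlg E)
    (g : formGroup E) (X : Matrix ι ι ℂ) : F (toMat g * X * toMat g⁻¹) = F X := by
  refine Algebra.adjoin_induction (p := fun F _ => F (toMat g * X * toMat g⁻¹) = F X) ?_
    (fun z => rfl) (fun _ _ _ _ h h' => ?_) (fun _ _ _ _ h h' => ?_) hF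
  · rintro F ⟨α, _, H, hH, hFH⟩
    rw [hFH, hFH]
    exact hH g fun _ => X
  · rw [Pi.add_apply, h, h', Pi.add_apply]
  · rw [Pi.mul_apply, h, h', Pi.mul_apply]

theorem springer_mem_repC (hE : IsForm E) {T : Subgroup (formGroup E)} {F : Matrix ι ι ℂ → ℂ}
    (hF : F ∈ invariantAlg E) : (fun t : T => F (springer hE t)) ∈ repC E T := by
  refine Submodule.span_induction (p := fun F _ => (fun t : T => F (springer hE t)) ∈ repC E T)
    ?_ (Submodule.zero_mem _) (fun _ _ _ _ h h' => Submodule.add_mem _ h h')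
    (fun c _ _ h => Submodule.smul_mem _ c h) (mem_span_of_mem_invariantAlg hF)
  rintro F ⟨α, _, H, hH, hFH⟩
  convert diagonal_form_mem_repC (T := T) (H.compLinearMap fun _ => skewPart E) ?_ using 2 with t
  · rw [hFH, springer_eq_skewPart]
    rfl
  · intro g A
    simp only [MultilinearMap.compLinearMap_apply, skewPart_conj hE]
    exact hH g _

/-- Conjugation-invariant functions give elements of the polynomial representation ring. -/
theorem mem_repPoly_of_mem_invariantAlg (hE : IsForm E) {T : Subgroup (formGroup E)}
    (𝔱 : Submodule ℂ (Matrix ι ι ℂ)) {F : Matrix ι ι ℂ → ℂ} (hF : F ∈ invariantAlg E) {f : T → ℂ}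
    (hf : ∀ t : T, f t = F (springer hE t)) : f ∈ repPoly hE T 𝔱 := by
  obtain ⟨p, hp⟩ := isRegular_of_mem_invariantAlg hF
  refine ⟨?_, p, fun w _ x _ => ?_, fun t => (hf t).trans (hp _)⟩
  · rw [funext hf]
    exact springer_mem_repC hE hF
  · have h := conj_invariant_of_mem_invariantAlg hF w x
    rwa [hp, hp] at h

theorem list_prod_conj (g : formGroup E) (l : List (Matrix ι ι ℂ)) :
    (l.map fun A => toMat g * A * toMat g⁻¹).prod = toMat g * l.prod * toMat g⁻¹ := by
  induction l with
  | nil => simp [toMat_mul_inv]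
  | cons A l ih =>
    rw [List.map_cons, List.prod_cons, ih, List.prod_cons]
    simp only [Matrix.mul_assoc]
    rw [← Matrix.mul_assoc (toMat g⁻¹) (toMat g), toMat_inv_mul, Matrix.one_mul]

theorem trace_pow_mem_invariantAlg (k : ℕ) :
    (fun X : Matrix ι ι ℂ => trace (X ^ k)) ∈ invariantAlg E := by
  refine Algebra.subset_adjoin ⟨Fin k, inferInstance, (Matrix.traceLinearMap ι ℂ ℂ).compMultilinearMap
    (MultilinearMap.mkPiAlgebraFin ℂ k (Matrix ι ι ℂ)), fun g A => ?_, fun X => ?_⟩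
  · simp only [LinearMap.compMultilinearMap_apply, MultilinearMap.mkPiAlgebraFin_apply,
      Matrix.traceLinearMap_apply]
    rw [← Function.comp_def (fun A => toMat g * A * toMat g⁻¹) A, ← List.map_ofFn, list_prod_conj,
      trace_mul_comm, ← Matrix.mul_assoc, toMat_inv_mul, Matrix.one_mul]
  · simp

end General

/-! ### Symmetric polynomials from traces of powers. -/

section Symmetric

/-- A subalgebra containing the power sums of positive degree contains all symmetric
polynomials. -/
theorem mem_of_isSymmetric_of_psum_mem {σ : Type} [Fintype σ]
    (B : Subalgebra ℂ (MvPolynomial σ ℂ)) (hB : ∀ k, 0 < k → MvPolynomial.psum σ ℂ k ∈ B)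
    {P : MvPolynomial σ ℂ} (hP : P.IsSymmetric) : P ∈ B := by
  -- Newton's identities, divided by `k` in characteristic zero, give the elementary symmetric
  -- polynomials by induction.
  have hesymm : ∀ k, MvPolynomial.esymm σ ℂ k ∈ B := by
    intro k
    induction k using Nat.strong_induction_on with
    | _ k ih =>
      rcases Nat.eq_zero_or_pos k with rfl | hk
      · rw [MvPolynomial.esymm_zero]
        exact B.one_mem
      have h := MvPolynomial.mul_esymm_eq_sum σ ℂ k
      have hk' : (k : ℂ) ≠ 0 := Nat.cast_ne_zero.2 hk.ne'
      have h2 : MvPolynomial.esymm σ ℂ k =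
          (k : ℂ)⁻¹ • ((k : MvPolynomial σ ℂ) * MvPolynomial.esymm σ ℂ k) := by
        rw [← nsmul_eq_mul, ← Nat.cast_smul_eq_nsmul ℂ, smul_smul, inv_mul_cancel₀ hk', one_smul]
      rw [h2, h]
      refine B.smul_mem (B.mul_mem (B.pow_mem (B.neg_mem B.one_mem) _)
        (B.sum_mem fun a ha => ?_)) _
      rw [Finset.mem_filter, Finset.HasAntidiagonal.mem_antidiagonal] at ha
      -- The condition `a.1 < k` serves twice: it feeds the induction and makes the degree `a.2` of
      -- the power sum positive.
      exact B.mul_mem (B.mul_mem (B.pow_mem (B.neg_mem B.one_mem) _) (ih _ ha.2))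
        (hB _ (by omega))
  obtain ⟨Q, hQ⟩ := MvPolynomial.esymmAlgHom_surjective (σ := σ) ℂ le_rfl
    (⟨P, hP⟩ : MvPolynomial.symmetricSubalgebra σ ℂ)
  have h := congrArg Subtype.val hQ
  rw [MvPolynomial.esymmAlgHom_apply] at h
  change _ = P at h
  rw [← h]
  have h3 := Subalgebra.mem_comap B (MvPolynomial.aeval
    (fun i : Fin (Fintype.card σ) => MvPolynomial.esymm σ ℂ (i + 1))) Q
  rw [← h3]
  have h4 : (⊤ : Subalgebra ℂ (MvPolynomial (Fin (Fintype.card σ)) ℂ)) ≤ B.comap (MvPolynomial.aeval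
    (fun i : Fin (Fintype.card σ) => MvPolynomial.esymm σ ℂ (i + 1))) := by
    rw [← MvPolynomial.adjoin_range_X, Algebra.adjoin_le_iff]
    rintro _ ⟨i, rfl⟩
    rw [SetLike.mem_coe, Subalgebra.mem_comap, MvPolynomial.aeval_X]
    exact hesymm _
  exact h4 Algebra.mem_top

/-- Symmetric polynomials in the squares of the coordinates of the Cartan subalgebra extend to
invariant functions. -/
theorem exists_invariant_of_isSymmetric {n : ℕ} {ι : Type} [Fintype ι] [DecidableEq ι]
    (E : Matrix ι ι ℂ) (δ : (Fin n → ℂ) → ι → ℂ)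
    (hδ : ∀ x k, 0 < k → ∑ i, δ x i ^ (2 * k) = 2 * ∑ i, x i ^ (2 * k))
    {P : MvPolynomial (Fin n) ℂ} (hP : P.IsSymmetric) :
    ∃ F ∈ invariantAlg E, ∀ x, F (diagonal (δ x)) = MvPolynomial.eval (fun i => x i ^ 2) P := by
  let R : (Matrix ι ι ℂ → ℂ) →ₐ[ℂ] ((Fin n → ℂ) → ℂ) :=
    AlgHom.pi fun x => Pi.evalAlgHom ℂ _ (diagonal (δ x))
  let Φ : MvPolynomial (Fin n) ℂ →ₐ[ℂ] ((Fin n → ℂ) → ℂ) :=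
    AlgHom.pi fun x => MvPolynomial.aeval fun i => x i ^ 2
  -- The weights come in pairs `±xᵢ`, so half the trace of `X ^ (2k)` is the `k`-th power sum of the
  -- squares.
  have h := mem_of_isSymmetric_of_psum_mem (((invariantAlg E).map R).comap Φ) (fun k hk => by
    rw [Subalgebra.mem_comap, Subalgebra.mem_map]
    refine ⟨_, (invariantAlg E).smul_mem (trace_pow_mem_invariantAlg (2 * k)) (1 / 2 : ℂ), ?_⟩
    funext x
    change (1 / 2 : ℂ) * trace (diagonal (δ x) ^ (2 * k)) =
      MvPolynomial.aeval (fun i => x i ^ 2) (MvPolynomial.psum (Fin n) ℂ k)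
    rw [diagonal_pow, trace_diagonal]
    simp only [Pi.pow_apply, hδ x k hk, MvPolynomial.psum, map_sum, map_pow, MvPolynomial.aeval_X,
      ← pow_mul]
    ring) hP
  obtain ⟨F, hF, hFP⟩ := h
  refine ⟨F, hF, fun x => ?_⟩
  have h2 := congrFun hFP x
  rw [← MvPolynomial.aeval_eq_eval]
  exact h2

end Symmetric

/-! ### Monomial matrices. -/

section Monomial

/-- The monomial matrix with entries `s j` in the positions `(π j, j)`. -/
def monomialMat {ι : Type} [DecidableEq ι] (π : Equiv.Perm ι) (s : ι → ℂ) : Matrix ι ι ℂ :=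
  (diagonal s).submatrix π.symm id

theorem monomialMat_apply {ι : Type} [DecidableEq ι] (π : Equiv.Perm ι) (s : ι → ℂ) (i j : ι) :
    monomialMat π s i j = if i = π j then s j else 0 := by
  by_cases h : i = π j
  · simp [monomialMat, h]
  · rw [if_neg h, monomialMat, submatrix_apply, diagonal_apply_ne]
    rwa [id, Ne, Equiv.symm_apply_eq]

end Monomial

/-! ### Weyl group elements and the Springer morphism on the torus. -/

section Torus

variable {ι : Type} [Fintype ι] [DecidableEq ι] {E : Matrix ι ι ℂ} {n : ℕ}

theorem det_monomialMat (π : Equiv.Perm ι) (s : ι → ℂ) :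
    (monomialMat π s).det = (Equiv.Perm.sign π : ℤ) * ∏ i, s i := by
  rw [monomialMat, det_permute, det_diagonal]
  congr 3
  exact Equiv.Perm.sign_symm π

theorem transpose_monomialMat_mul_mul (π : Equiv.Perm ι) (s : ι → ℂ)
    (h : ∀ i j, s i * E (π i) (π j) * s j = E i j) :
    (monomialMat π s)ᵀ * E * monomialMat π s = E := by
  ext i j
  rw [← h i j]
  simp [Matrix.mul_apply, monomialMat_apply]

theorem monomialMat_mul_diagonal (π : Equiv.Perm ι) (s e e' : ι → ℂ) (h : ∀ i, e' (π i) = e i) :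
    monomialMat π s * diagonal e = diagonal e' * monomialMat π s := by
  ext i j
  rw [mul_diagonal, diagonal_mul, monomialMat_apply]
  split_ifs with hij
  · rw [hij, h, mul_comm]
  · simp

/-- The linear coordinate change `ψ` of the Cartan subalgebra is realized by a monomial matrix in
the normalizer of the torus. -/
def IsMonomialSymmetry (E : Matrix ι ι ℂ) (d : (Fin n → ℂˣ) → ι → ℂ)
    (δ : (Fin n → ℂ) → ι → ℂ) (ψ : (Fin n → ℂ) → Fin n → ℂ) : Prop :=
  ∃ (π : Equiv.Perm ι) (s : ι → ℂ) (φ : Equiv.Perm (Fin n → ℂˣ)),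
    ((Equiv.Perm.sign π : ℤ) : ℂ) * ∏ i, s i = 1 ∧
    (∀ i j, s i * E (π i) (π j) * s j = E i j) ∧
    (∀ t i, d (φ t) (π i) = d t i) ∧ ∀ x i, δ (ψ x) (π i) = δ x i

variable {d : (Fin n → ℂˣ) →* (ι → ℂ)} (hdet : ∀ t, ∏ i, d t i = 1)
  (hdE : ∀ t i j, d t i * E i j * d t j = E i j)

theorem toMat_diagHom (t : Fin n → ℂˣ) : toMat (diagHom E d hdet hdE t) = diagonal (d t) := rfl

/-- Conjugation by a monomial matrix relabels diagonal entries through `π`; the scalars `s` only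
serve to put it in the group. As `φ` is bijective, the torus is mapped onto itself. -/
theorem IsMonomialSymmetry.exists_mem_normalizer {δ : (Fin n → ℂ) → ι → ℂ}
    {ψ : (Fin n → ℂ) → Fin n → ℂ} (h : IsMonomialSymmetry E d δ ψ) :
    ∃ w ∈ Subgroup.normalizer ((diagHom E d hdet hdE).range : Set (formGroup E)),
      ∀ x, toMat w * diagonal (δ x) * toMat w⁻¹ = diagonal (δ (ψ x)) := by
  obtain ⟨π, s, φ, h1, h2, h3, h4⟩ := h
  let w : formGroup E := ⟨⟨monomialMat π s, by rw [det_monomialMat, h1]⟩,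
    transpose_monomialMat_mul_mul π s h2⟩
  have hw : toMat w = monomialMat π s := rfl
  have hconj : ∀ e e' : ι → ℂ, (∀ i, e' (π i) = e i) →
      toMat w * diagonal e * toMat w⁻¹ = diagonal e' := by
    intro e e' h
    rw [hw, monomialMat_mul_diagonal π s e e' h, ← hw, Matrix.mul_assoc, toMat_mul_inv,
      Matrix.mul_one]
  have htorus : ∀ t, w * diagHom E d hdet hdE t * w⁻¹ = diagHom E d hdet hdE (φ t) := by
    intro t
    apply toMat_injective
    rw [toMat_mul, toMat_mul, toMat_diagHom, toMat_diagHom]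
    exact hconj _ _ (h3 t)
  refine ⟨w, ?_, fun x => hconj _ _ (h4 x)⟩
  rw [Subgroup.mem_normalizer_iff]
  intro g
  constructor
  · rintro ⟨t, rfl⟩
    exact ⟨φ t, (htorus t).symm⟩
  · rintro ⟨t, ht⟩
    refine ⟨φ.symm t, ?_⟩
    have h5 := htorus (φ.symm t)
    rw [Equiv.apply_symm_apply, ht] at h5
    exact mul_left_cancel (mul_right_cancel h5)

/-- Preserving the form makes the adjoint of `diag (d)` equal to `diag (d⁻¹)`, whence the half
differences. -/
theorem springer_diagHom (hE : IsForm E) {δ : (Fin n → ℂ) → ι → ℂ}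
    (hδ : ∀ t i, (d t i - (d t i)⁻¹) / 2 = δ (halfDiff t) i) (t : Fin n → ℂˣ) :
    springer hE (diagHom E d hdet hdE t) = diagonal (δ (halfDiff t)) := by
  have hne : ∀ i, d t i ≠ 0 := fun i h => by
    have h1 := hdet t
    rw [Finset.prod_eq_zero (Finset.mem_univ i) h] at h1
    exact zero_ne_one h1
  have h1 : diagonal (d t) * E = E * diagonal fun i => (d t i)⁻¹ := by
    ext i j
    rw [diagonal_mul, mul_diagonal, eq_mul_inv_iff_mul_eq₀ (hne j), hdE]
  rw [springer_eq_skewPart, toMat_diagHom, skewPart_apply, diagonal_transpose, Matrix.mul_assoc, h1,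
    ← Matrix.mul_assoc, hE.inv_mul, Matrix.one_mul, diagonal_sub, ← diagonal_smul]
  congr 1
  funext i
  rw [← hδ]
  simp only [Pi.smul_apply, smul_eq_mul]
  ring

/-- An element of the polynomial representation ring is a polynomial in the coordinates
`(tᵢ - tᵢ⁻¹) / 2` that is invariant under all monomial symmetries. -/
theorem exists_polynomial_of_mem_repPoly (hE : IsForm E) {𝔱 : Submodule ℂ (Matrix ι ι ℂ)}
    {δ : (Fin n → ℂ) → ι → ℂ} (D : ι → MvPolynomial (Fin n) ℂ)
    (hD : ∀ x i, δ x i = MvPolynomial.eval x (D i)) (h𝔱 : ∀ x, diagonal (δ x) ∈ 𝔱)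
    (hδ : ∀ t i, (d t i - (d t i)⁻¹) / 2 = δ (halfDiff t) i)
    {f : (diagHom E d hdet hdE).range → ℂ}
    (hf : f ∈ repPoly hE (diagHom E d hdet hdE).range 𝔱) :
    ∃ q : MvPolynomial (Fin n) ℂ,
      (∀ t, f ((diagHom E d hdet hdE).rangeRestrict t) = MvPolynomial.eval (halfDiff t) q) ∧
      ∀ ψ, IsMonomialSymmetry E d δ ψ →
        ∀ x, MvPolynomial.eval (ψ x) q = MvPolynomial.eval x q := by
  obtain ⟨-, p, hp, hfp⟩ := hf
  -- Restriction of `p` to the Cartan subalgebra: off-diagonal variables become zero, diagonal ones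
  -- the linear forms `D`.
  obtain ⟨q, hqp⟩ : ∃ q, q = MvPolynomial.bind₁
      (fun ij : ι × ι => if ij.1 = ij.2 then D ij.1 else 0) p := ⟨_, rfl⟩
  have hq : ∀ x, MvPolynomial.eval x q = polyEval p (diagonal (δ x)) := by
    intro x
    rw [hqp, polyEval, ← MvPolynomial.coe_aeval_eq_eval, ← MvPolynomial.coe_aeval_eq_eval]
    simp only [RingHom.coe_coe, MvPolynomial.aeval_bind₁]
    congr 2
    funext ij
    rw [diagonal_apply]
    split_ifs with h
    · rw [hD, ← MvPolynomial.coe_aeval_eq_eval]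
      rfl
    · simp
  refine ⟨q, fun t => ?_, fun ψ hψ x => ?_⟩
  · rw [hfp, hq]
    exact congrArg _ (springer_diagHom hdet hdE hE hδ t)
  · obtain ⟨w, hw, hwx⟩ := hψ.exists_mem_normalizer hdet hdE
    rw [hq, hq, ← hwx]
    exact hp w hw _ (h𝔱 x)

end Torus

/-! ### Polynomials invariant under sign changes and permutations. -/

section Polynomials

variable {n : ℕ}

theorem eval_diagonal_scaling (s x : Fin n → ℂ) (q : MvPolynomial (Fin n) ℂ) :
    MvPolynomial.eval (fun i => s i * x i) q = MvPolynomial.eval x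
      (∑ m ∈ q.support, MvPolynomial.monomial m ((∏ i, s i ^ m i) * q.coeff m)) := by
  rw [MvPolynomial.eval_eq', map_sum]
  refine Finset.sum_congr rfl fun m _ => ?_
  rw [MvPolynomial.eval_monomial, Finsupp.prod_fintype _ _ (fun _ => pow_zero _)]
  simp only [mul_pow, Finset.prod_mul_distrib]
  ring

/-- Scaling multiplies the coefficient of `m` by `∏ sᵢ ^ mᵢ`, and over `ℂ` equal values mean equal
coefficients. -/
theorem prod_pow_eq_one_of_scaling_invariant {q : MvPolynomial (Fin n) ℂ} {s : Fin n → ℂ}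
    (h : ∀ x, MvPolynomial.eval (fun i => s i * x i) q = MvPolynomial.eval x q) {m : Fin n →₀ ℕ}
    (hm : m ∈ q.support) : ∏ i, s i ^ m i = 1 := by
  classical
  have h1 : (∑ m ∈ q.support, MvPolynomial.monomial m ((∏ i, s i ^ m i) * q.coeff m)) = q :=
    MvPolynomial.funext fun x => by rw [← eval_diagonal_scaling, h]
  have h2 := congrArg (MvPolynomial.coeff m) h1
  rw [MvPolynomial.coeff_sum] at h2
  simp only [MvPolynomial.coeff_monomial] at h2
  rw [Finset.sum_ite_eq' q.support m, if_pos hm] at h2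
  exact mul_right_cancel₀ (MvPolynomial.mem_support_iff.1 hm) (h2.trans (one_mul _).symm)

/-- A sum of monomials whose exponents have the same parities as `e` is a monomial times a
polynomial in the squares of the variables. -/
theorem exists_eval_sq_of_parity (q : MvPolynomial (Fin n) ℂ) (e : ℕ) (S : Finset (Fin n →₀ ℕ))
    (hS : ∀ m ∈ S, ∀ i, ∃ k, m i = e + 2 * k) :
    ∃ P : MvPolynomial (Fin n) ℂ, ∀ x : Fin n → ℂ, ∑ m ∈ S, q.coeff m * ∏ i, x i ^ m i =
      (∏ i, x i) ^ e * MvPolynomial.eval (fun i => x i ^ 2) P := by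
  refine ⟨∑ m ∈ S, MvPolynomial.monomial
    (Finsupp.equivFunOnFinite.symm fun i => (m i - e) / 2) (q.coeff m), fun x => ?_⟩
  rw [map_sum, Finset.mul_sum]
  refine Finset.sum_congr rfl fun m hm => ?_
  rw [MvPolynomial.eval_monomial, Finsupp.prod_fintype _ _ (fun _ => pow_zero _), mul_left_comm,
    ← Finset.prod_pow, ← Finset.prod_mul_distrib]
  congr 1
  refine Finset.prod_congr rfl fun i _ => ?_
  obtain ⟨k, hk⟩ := hS m hm i
  have : (m i - e) / 2 = k := by omega
  rw [Finsupp.equivFunOnFinite_symm_apply_apply, this, hk, pow_add, pow_mul]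

/-- The average of a polynomial over all permutations of the variables. -/
def symmetrize (P : MvPolynomial (Fin n) ℂ) : MvPolynomial (Fin n) ℂ :=
  (Fintype.card (Equiv.Perm (Fin n)) : ℂ)⁻¹ • ∑ σ : Equiv.Perm (Fin n), MvPolynomial.rename σ P

theorem isSymmetric_symmetrize (P : MvPolynomial (Fin n) ℂ) : (symmetrize P).IsSymmetric := by
  intro τ
  rw [symmetrize, map_smul, map_sum]
  congr 1
  conv_rhs => rw [← Equiv.sum_comp (Equiv.mulLeft τ)]
  refine Finset.sum_congr rfl fun σ _ => ?_
  rw [MvPolynomial.rename_rename]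
  rfl

theorem eval_symmetrize (P : MvPolynomial (Fin n) ℂ) (x : Fin n → ℂ) :
    MvPolynomial.eval x (symmetrize P) = (Fintype.card (Equiv.Perm (Fin n)) : ℂ)⁻¹ *
      ∑ σ : Equiv.Perm (Fin n), MvPolynomial.eval (fun i => x (σ i)) P := by
  rw [symmetrize, MvPolynomial.smul_eval, map_sum]
  simp only [MvPolynomial.eval_rename]
  rfl

/-- Permutations fix `∏ xᵢ`, so averaging the decomposition of `q` averages `P` and `Q` separately;
no uniqueness of `P` and `Q` is needed. -/
theorem eval_eq_eval_symmetrize {q P Q : MvPolynomial (Fin n) ℂ}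
    (hperm : ∀ (σ : Equiv.Perm (Fin n)) x,
      MvPolynomial.eval (fun i => x (σ i)) q = MvPolynomial.eval x q)
    (h : ∀ x, MvPolynomial.eval x q = MvPolynomial.eval (fun i => x i ^ 2) P +
      (∏ i, x i) * MvPolynomial.eval (fun i => x i ^ 2) Q) (x : Fin n → ℂ) :
    MvPolynomial.eval x q = MvPolynomial.eval (fun i => x i ^ 2) (symmetrize P) +
      (∏ i, x i) * MvPolynomial.eval (fun i => x i ^ 2) (symmetrize Q) := by
  have hc : (Fintype.card (Equiv.Perm (Fin n)) : ℂ) ≠ 0 := Nat.cast_ne_zero.2 Fintype.card_ne_zero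
  have h1 : ∑ σ : Equiv.Perm (Fin n), MvPolynomial.eval (fun i => x (σ i)) q =
      (Fintype.card (Equiv.Perm (Fin n)) : ℂ) * MvPolynomial.eval x q := by
    simp [hperm]
  have h2 : ∀ σ : Equiv.Perm (Fin n), ∏ i, x (σ i) = ∏ i, x i := fun σ => Equiv.prod_comp σ x
  simp only [h, h2, Finset.sum_add_distrib, ← Finset.mul_sum] at h1
  rw [eval_symmetrize, eval_symmetrize, h]
  field_simp
  linear_combination -h1

theorem eval_eq_of_even_sign_invariant {q : MvPolynomial (Fin n) ℂ}
    (hsign : ∀ i j, i ≠ j → ∀ x, MvPolynomial.eval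
      (fun k => (if k = i ∨ k = j then -1 else 1) * x k) q = MvPolynomial.eval x q) :
    ∃ P Q : MvPolynomial (Fin n) ℂ, ∀ x, MvPolynomial.eval x q =
      MvPolynomial.eval (fun i => x i ^ 2) P +
      (∏ i, x i) * MvPolynomial.eval (fun i => x i ^ 2) Q := by
  classical
  -- Changing the signs of `xᵢ` and `xⱼ` multiplies the monomial by `(-1) ^ (mᵢ + mⱼ)`, so all
  -- exponents share a parity. Even monomials go to `P`, odd ones to `Q`.
  have hpar : ∀ m ∈ q.support, ∀ i j, Even (m i + m j) := by
    intro m hm i j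
    by_cases hij : i = j
    · rw [hij]; exact ⟨_, rfl⟩
    have h := prod_pow_eq_one_of_scaling_invariant (hsign i j hij) hm
    have h2 : ∀ k, (if k = i ∨ k = j then (-1 : ℂ) else 1) ^ m k =
        (if k = i then (-1) ^ m k else 1) * (if k = j then (-1) ^ m k else 1) := by
      intro k
      by_cases h1 : k = i
      · subst h1; simp [hij]
      · by_cases h2 : k = j
        · subst h2; simp [h1]
        · simp [h1, h2]
    simp only [h2, Finset.prod_mul_distrib, Finset.prod_ite_eq', Finset.mem_univ, if_true,
      ← pow_add] at h
    exact (neg_one_pow_eq_one_iff_even (by norm_num)).1 h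
  obtain ⟨P, hP⟩ := exists_eval_sq_of_parity q 0 (q.support.filter fun m => ∀ i, Even (m i))
    (fun m hm i => by
      obtain ⟨k, hk⟩ := (Finset.mem_filter.1 hm).2 i
      exact ⟨k, by omega⟩)
  obtain ⟨Q, hQ⟩ := exists_eval_sq_of_parity q 1 (q.support.filter fun m => ¬ ∀ i, Even (m i))
    (fun m hm i => by
      rw [Finset.mem_filter] at hm
      obtain ⟨hm, h2⟩ := hm
      push Not at h2
      obtain ⟨j, hj⟩ := h2
      obtain ⟨k, hk⟩ : Odd (m i) := by
        have h := hpar m hm i j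
        grind
      exact ⟨k, by omega⟩)
  refine ⟨P, Q, fun x => ?_⟩
  rw [MvPolynomial.eval_eq', ← Finset.sum_filter_add_sum_filter_not q.support
    (fun m => ∀ i, Even (m i)), hP, hQ, pow_zero, one_mul, pow_one]

theorem eval_eq_of_sign_invariant {q : MvPolynomial (Fin n) ℂ}
    (hsign : ∀ i x, MvPolynomial.eval
      (fun k => (if k = i then -1 else 1) * x k) q = MvPolynomial.eval x q) :
    ∃ P : MvPolynomial (Fin n) ℂ, ∀ x, MvPolynomial.eval x q =
      MvPolynomial.eval (fun i => x i ^ 2) P := by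
  obtain ⟨P, hP⟩ := exists_eval_sq_of_parity q 0 q.support (fun m hm i => by
    have h := prod_pow_eq_one_of_scaling_invariant (hsign i) hm
    simp only [ite_pow, one_pow, Finset.prod_ite_eq', Finset.mem_univ, if_true] at h
    obtain ⟨k, hk⟩ := (neg_one_pow_eq_one_iff_even (by norm_num)).1 h
    exact ⟨k, by omega⟩)
  exact ⟨P, fun x => by rw [MvPolynomial.eval_eq', hP, pow_zero, one_mul]⟩

end Polynomials

/-! ### The Pfaffian as an invariant form in type D. -/

section Pfaffian

variable {n : ℕ}

/-- The polarization of (a multiple of) the Pfaffian of matrices of size `2n`. -/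
def polarPfaffian (n : ℕ) :
    MultilinearMap ℂ (fun _ : Fin n => Matrix (Fin n ⊕ Fin n) (Fin n ⊕ Fin n) ℂ) ℂ :=
  ∑ σ : Equiv.Perm (Fin n ⊕ Fin n), ((Equiv.Perm.sign σ : ℤ) : ℂ) •
    (MultilinearMap.mkPiAlgebra ℂ (Fin n) ℂ).compLinearMap
      (fun i => Matrix.entryLinearMap ℂ ℂ (σ (Sum.inl i)) (σ (Sum.inr (Fin.rev i))))

theorem polarPfaffian_apply (A : Fin n → Matrix (Fin n ⊕ Fin n) (Fin n ⊕ Fin n) ℂ) :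
    polarPfaffian n A = ∑ σ : Equiv.Perm (Fin n ⊕ Fin n), ((Equiv.Perm.sign σ : ℤ) : ℂ) *
      ∏ i, A i (σ (Sum.inl i)) (σ (Sum.inr (Fin.rev i))) := by
  simp [polarPfaffian]

theorem prod_sum_rev {M : Type} [CommMonoid M] (f : Fin n ⊕ Fin n → M) :
    ∏ k, f k = (∏ i, f (Sum.inl i)) * ∏ i, f (Sum.inr (Fin.rev i)) := by
  rw [Fintype.prod_sum_type, ← Equiv.prod_comp Fin.revPerm (fun i => f (Sum.inr i))]
  rfl

theorem sum_sign_mul_prod (w : Matrix (Fin n ⊕ Fin n) (Fin n ⊕ Fin n) ℂ)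
    (φ : Fin n ⊕ Fin n → Fin n ⊕ Fin n) :
    ∑ σ : Equiv.Perm (Fin n ⊕ Fin n), ((Equiv.Perm.sign σ : ℤ) : ℂ) * ∏ k, w (φ k) (σ k) =
      (w.submatrix φ id).det := by
  rw [← det_transpose, det_apply']
  rfl

/-- Expanding the products leaves a sum over index maps `φ`, in which the signed sum over `σ` is the
determinant of the rows of `w` chosen by `φ`. It vanishes for a repeated row and is `sign φ * det w`
for a permutation. -/
theorem polarPfaffian_congr_transform (w : Matrix (Fin n ⊕ Fin n) (Fin n ⊕ Fin n) ℂ)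
    (A : Fin n → Matrix (Fin n ⊕ Fin n) (Fin n ⊕ Fin n) ℂ) :
    polarPfaffian n (fun i => wᵀ * A i * w) = w.det * polarPfaffian n A := by
  have h1 : ∀ σ : Equiv.Perm (Fin n ⊕ Fin n),
      ∏ i, (wᵀ * A i * w) (σ (Sum.inl i)) (σ (Sum.inr (Fin.rev i))) =
      ∑ φ : Fin n ⊕ Fin n → Fin n ⊕ Fin n, (∏ k, w (φ k) (σ k)) *
        ∏ i, A i (φ (Sum.inl i)) (φ (Sum.inr (Fin.rev i))) := by
    intro σ
    have h2 : ∀ i, (wᵀ * A i * w) (σ (Sum.inl i)) (σ (Sum.inr (Fin.rev i))) =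
        ∑ p : (Fin n ⊕ Fin n) × (Fin n ⊕ Fin n), w p.1 (σ (Sum.inl i)) * A i p.1 p.2 *
          w p.2 (σ (Sum.inr (Fin.rev i))) := by
      intro i
      rw [Fintype.sum_prod_type_right]
      simp only [Matrix.mul_apply, Finset.sum_mul, transpose_apply]
    simp only [h2]
    rw [Finset.prod_univ_sum, Fintype.piFinset_univ]
    -- Choosing a pair of indices for each `i` is choosing one for each of the `2n` positions, where
    -- `i` is paired with position `Fin.rev i` of the right half.
    let e : (Fin n ⊕ Fin n → Fin n ⊕ Fin n) ≃ (Fin n → (Fin n ⊕ Fin n) × (Fin n ⊕ Fin n)) :=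
      (Equiv.sumArrowEquivProdArrow _ _ _).trans
        (((Equiv.refl _).prodCongr (Fin.revPerm.arrowCongr (Equiv.refl _))).trans
          (Equiv.arrowProdEquivProdArrow _ _ _).symm)
    rw [← e.sum_comp]
    refine Finset.sum_congr rfl fun φ _ => ?_
    have he : ∀ i, e φ i = (φ (Sum.inl i), φ (Sum.inr (Fin.rev i))) := fun i => rfl
    simp only [he, prod_sum_rev, Finset.prod_mul_distrib]
    ring
  rw [polarPfaffian_apply, polarPfaffian_apply]
  simp only [h1, Finset.mul_sum, ← mul_assoc]
  rw [Finset.sum_comm]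
  simp only [← Finset.sum_mul, sum_sign_mul_prod]
  rw [← Finset.sum_filter_add_sum_filter_not Finset.univ
    (fun φ : Fin n ⊕ Fin n → Fin n ⊕ Fin n => Function.Bijective φ)]
  have h3 : ∑ φ : Fin n ⊕ Fin n → Fin n ⊕ Fin n with ¬ Function.Bijective φ,
      (w.submatrix φ id).det * ∏ i, A i (φ (Sum.inl i)) (φ (Sum.inr (Fin.rev i))) = 0 := by
    refine Finset.sum_eq_zero fun φ hφ => ?_
    rw [Finset.mem_filter, ← Finite.injective_iff_bijective, Function.Injective] at hφ
    have h4 := hφ.2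
    push Not at h4
    obtain ⟨i, j, hij, hne⟩ := h4
    rw [det_zero_of_row_eq hne (by ext k; simp [hij]), zero_mul]
  rw [h3, add_zero]
  symm
  refine Finset.sum_bij (fun σ _ => ⇑σ) (fun σ _ => ?_) (fun _ _ _ _ h => DFunLike.coe_injective h)
    (fun φ hφ => ⟨Equiv.ofBijective φ (Finset.mem_filter.1 hφ).2, Finset.mem_univ _, rfl⟩)
    (fun σ _ => ?_)
  · exact Finset.mem_filter.2 ⟨Finset.mem_univ _, σ.bijective⟩
  · rw [det_permute]
    ring

/-- The Gram matrix of the standard alternating form. -/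
def altForm (n : ℕ) : Matrix (Fin n ⊕ Fin n) (Fin n ⊕ Fin n) ℂ :=
  fromBlocks 0 (antidiag n) (-antidiag n) 0

theorem altForm_swap (k l : Fin n ⊕ Fin n) : altForm n k l = -altForm n l k := by
  have h : ∀ a b, antidiag n a b = antidiag n b a := fun a b =>
    congrFun (congrFun (antidiag_transpose n) b) a
  rcases k with k | k <;> rcases l with l | l <;> simp [altForm, h l k]

/-- Exchanging the two indices of one pair flips both the sign of `σ` and one alternating factor. -/
theorem pfaffian_term_swap (σ : Equiv.Perm (Fin n ⊕ Fin n)) (i : Fin n) :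
    ((Equiv.Perm.sign (σ * Equiv.swap (Sum.inl i) (Sum.inr (Fin.rev i))) : ℤ) : ℂ) *
      ∏ j, altForm n ((σ * Equiv.swap (Sum.inl i) (Sum.inr (Fin.rev i))) (Sum.inl j))
        ((σ * Equiv.swap (Sum.inl i) (Sum.inr (Fin.rev i))) (Sum.inr (Fin.rev j))) =
    ((Equiv.Perm.sign σ : ℤ) : ℂ) *
      ∏ j, altForm n (σ (Sum.inl j)) (σ (Sum.inr (Fin.rev j))) := by
  rw [Equiv.Perm.sign_mul, Equiv.Perm.sign_swap (by simp)]
  rw [← Finset.mul_prod_erase _ _ (Finset.mem_univ i), ← Finset.mul_prod_erase _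
    (fun j => altForm n (σ (Sum.inl j)) (σ (Sum.inr (Fin.rev j)))) (Finset.mem_univ i)]
  have h : ∏ j ∈ Finset.univ.erase i,
      altForm n ((σ * Equiv.swap (Sum.inl i) (Sum.inr (Fin.rev i))) (Sum.inl j))
        ((σ * Equiv.swap (Sum.inl i) (Sum.inr (Fin.rev i))) (Sum.inr (Fin.rev j))) =
      ∏ j ∈ Finset.univ.erase i, altForm n (σ (Sum.inl j)) (σ (Sum.inr (Fin.rev j))) := by
    refine Finset.prod_congr rfl fun j hj => ?_
    have hj := Finset.ne_of_mem_erase hj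
    rw [Equiv.Perm.mul_apply, Equiv.Perm.mul_apply, Equiv.swap_apply_of_ne_of_ne (by simpa using hj)
      (by simp), Equiv.swap_apply_of_ne_of_ne (by simp) (by simpa using hj)]
  rw [h, Equiv.Perm.mul_apply, Equiv.Perm.mul_apply, Equiv.swap_apply_left, Equiv.swap_apply_right,
    altForm_swap]
  push_cast
  ring

theorem sign_revPerm_conj (τ : Equiv.Perm (Fin n)) :
    Equiv.Perm.sign (Fin.revPerm.trans (τ.trans Fin.revPerm)) = Equiv.Perm.sign τ := by
  rw [Equiv.Perm.sign_trans, Equiv.Perm.sign_trans, mul_comm, mul_left_comm, ← mul_assoc,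
    ← sq, Int.units_sq, one_mul]

/-- Nonvanishing forces `σ` to act on the right half as the reversed copy of its action on the left
half, so its sign is a square. -/
theorem pfaffian_term_of_isLeft (σ : Equiv.Perm (Fin n ⊕ Fin n))
    (hσ : ∀ i, (σ (Sum.inl i)).isLeft)
    (hne : ∏ j, altForm n (σ (Sum.inl j)) (σ (Sum.inr (Fin.rev j))) ≠ 0) :
    ((Equiv.Perm.sign σ : ℤ) : ℂ) *
      ∏ j, altForm n (σ (Sum.inl j)) (σ (Sum.inr (Fin.rev j))) = 1 := by
  choose ρ hρ using fun i => Sum.isLeft_iff.1 (hσ i)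
  have hfac : ∀ j, σ (Sum.inr (Fin.rev j)) = Sum.inr (Fin.rev (ρ j)) := by
    intro j
    have h := Finset.prod_ne_zero_iff.1 hne j (Finset.mem_univ j)
    rw [hρ] at h
    rcases hs : σ (Sum.inr (Fin.rev j)) with k | k
    · rw [hs] at h
      simp [altForm] at h
    · rw [hs] at h
      simp [altForm, antidiag] at h
      rw [h]
  have hinj : Function.Injective ρ := fun i j hij => by
    have : σ (Sum.inl i) = σ (Sum.inl j) := by rw [hρ, hρ, hij]
    simpa using this
  let τ : Equiv.Perm (Fin n) := Equiv.ofBijective ρ (Finite.injective_iff_bijective.1 hinj)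
  have hστ : σ = Equiv.Perm.sumCongr τ (Fin.revPerm.trans (τ.trans Fin.revPerm)) := by
    ext k
    rcases k with k | k
    · exact hρ k
    · have := hfac (Fin.rev k)
      rw [Fin.rev_rev] at this
      exact this
  have hsign : Equiv.Perm.sign σ = 1 := by
    rw [hστ, Equiv.Perm.sign_sumCongr, sign_revPerm_conj, ← sq, Int.units_sq]
  rw [hsign]
  simp [hρ, hfac, altForm, antidiag]

/-- Each pair sent to the wrong sides is swapped back at no cost, by induction on their number,
until left indices stay left. -/
theorem pfaffian_term_eq (σ : Equiv.Perm (Fin n ⊕ Fin n))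
    (hne : ∏ j, altForm n (σ (Sum.inl j)) (σ (Sum.inr (Fin.rev j))) ≠ 0) :
    ((Equiv.Perm.sign σ : ℤ) : ℂ) *
      ∏ j, altForm n (σ (Sum.inl j)) (σ (Sum.inr (Fin.rev j))) = 1 := by
  induction hc : (Finset.univ.filter fun i => (σ (Sum.inl i)).isRight).card using
    Nat.strong_induction_on generalizing σ with
  | _ c ih =>
    by_cases hσ : ∀ i, (σ (Sum.inl i)).isLeft
    · exact pfaffian_term_of_isLeft σ hσ hne
    push Not at hσ
    obtain ⟨i, hi⟩ := hσ
    have hi : (σ (Sum.inl i)).isRight := by simpa using hi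
    have hnei := Finset.prod_ne_zero_iff.1 hne i (Finset.mem_univ i)
    set σ' := σ * Equiv.swap (Sum.inl i) (Sum.inr (Fin.rev i)) with hσ'
    have hi' : (σ' (Sum.inl i)).isLeft := by
      rw [hσ', Equiv.Perm.mul_apply, Equiv.swap_apply_left]
      obtain ⟨a, ha⟩ := Sum.isRight_iff.1 hi
      rw [ha] at hnei
      rcases hs : σ (Sum.inr (Fin.rev i)) with k | k
      · rfl
      · rw [hs] at hnei
        simp [altForm] at hnei
    have hj : ∀ j, j ≠ i → σ' (Sum.inl j) = σ (Sum.inl j) := by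
      intro j hj
      rw [hσ', Equiv.Perm.mul_apply, Equiv.swap_apply_of_ne_of_ne (by simpa using hj) (by simp)]
    have hterm := pfaffian_term_swap σ i
    rw [← hσ'] at hterm
    have hne0 : ∀ τ : Equiv.Perm (Fin n ⊕ Fin n), ((Equiv.Perm.sign τ : ℤ) : ℂ) ≠ 0 := fun τ =>
      Int.cast_ne_zero.2 (Units.ne_zero _)
    rw [← hterm]
    refine ih _ ?_ σ' (fun h0 => ?_) rfl
    · rw [← hc]
      refine Finset.card_lt_card ⟨fun j hjm => ?_, fun hsub => ?_⟩
      · rw [Finset.mem_filter] at hjm ⊢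
        have hji : j ≠ i := by
          rintro rfl
          obtain ⟨a, ha⟩ := Sum.isLeft_iff.1 hi'
          rw [ha] at hjm
          simp at hjm
        rw [hj j hji] at hjm
        exact hjm
      · have := (Finset.mem_filter.1 (hsub (Finset.mem_filter.2 ⟨Finset.mem_univ i, hi⟩))).2
        obtain ⟨a, ha⟩ := Sum.isLeft_iff.1 hi'
        rw [ha] at this
        simp at this
    · rw [h0, mul_zero] at hterm
      exact mul_ne_zero (hne0 σ) hne hterm.symm

/-- Nonzero terms all equal 1, so the sum counts them, and the identity contributes one. Only
nonvanishing is needed, to normalize the Pfaffian. -/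
theorem polarPfaffian_altForm_ne_zero : polarPfaffian n (fun _ => altForm n) ≠ 0 := by
  classical
  rw [polarPfaffian_apply]
  have h : ∀ σ : Equiv.Perm (Fin n ⊕ Fin n), ((Equiv.Perm.sign σ : ℤ) : ℂ) *
      ∏ i, altForm n (σ (Sum.inl i)) (σ (Sum.inr (Fin.rev i))) =
      ((if ∏ i, altForm n (σ (Sum.inl i)) (σ (Sum.inr (Fin.rev i))) ≠ 0 then 1 else 0 : ℕ) : ℂ) := by
    intro σ
    split_ifs with hne
    · rw [pfaffian_term_eq σ hne, Nat.cast_one]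
    · rw [not_not.1 hne, mul_zero, Nat.cast_zero]
  simp only [h]
  rw [← Nat.cast_sum, Nat.cast_ne_zero]
  refine (Finset.sum_pos' (fun _ _ => Nat.zero_le _) ⟨1, Finset.mem_univ _, ?_⟩).ne'
  rw [if_pos]
  · exact Nat.one_pos
  · simp [altForm, antidiag]

/-- The product of the coordinates of the Cartan subalgebra of the even orthogonal group extends
to an invariant function. -/
theorem exists_invariant_eq_prod (n : ℕ) : ∃ F ∈ invariantAlg (formD n), ∀ x : Fin n → ℂ,
    F (diagonal (Sum.elim x (fun i => -x (Fin.rev i)))) = ∏ i, x i := by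
  set c := polarPfaffian n (fun _ => -altForm n) with hc
  have hc0 : c ≠ 0 := by
    have h := (polarPfaffian n).map_smul_univ (fun _ => (-1 : ℂ)) (fun _ => altForm n)
    simp only [neg_smul, one_smul] at h
    rw [hc, h]
    exact smul_ne_zero (Finset.prod_ne_zero_iff.2 fun _ _ => by norm_num)
      polarPfaffian_altForm_ne_zero
  let H : MultilinearMap ℂ (fun _ : Fin n => Matrix (Fin n ⊕ Fin n) (Fin n ⊕ Fin n) ℂ) ℂ :=
    (polarPfaffian n).compLinearMap fun _ => LinearMap.mulLeft ℂ (formD n)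
  have hH : IsConjInvariant (formD n) H := by
    intro g A
    -- Multiplication by the form turns conjugation into congruence by `g⁻¹`, under which the
    -- Pfaffian scales by its determinant, which is 1.
    have h : ∀ i, formD n * (toMat g * A i * toMat g⁻¹) =
        (toMat g⁻¹)ᵀ * (formD n * A i) * toMat g⁻¹ := by
      intro i
      rw [← Matrix.mul_assoc (toMat g⁻¹)ᵀ, transpose_toMat_mul, inv_inv]
      simp only [Matrix.mul_assoc]
    simp only [H, MultilinearMap.compLinearMap_apply, LinearMap.mulLeft_apply, h]
    rw [polarPfaffian_congr_transform, det_toMat, one_mul]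
  refine ⟨c⁻¹ • fun X => H fun _ => X, Subalgebra.smul_mem _
    (Algebra.subset_adjoin (show (fun X => H fun _ => X) ∈ invariantForms (formD n) from
      ⟨Fin n, inferInstance, H, hH, fun _ => rfl⟩)) _, fun x => ?_⟩
  -- On the Cartan subalgebra `E X` is congruent to a fixed matrix through `diag (x, 1)`, whose
  -- determinant is the wanted product.
  have hform : formD n * diagonal (Sum.elim x (fun i => -x (Fin.rev i))) =
      (diagonal (Sum.elim x 1 : Fin n ⊕ Fin n → ℂ))ᵀ * (-altForm n) *
        diagonal (Sum.elim x 1 : Fin n ⊕ Fin n → ℂ) := by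
    ext k l
    rw [diagonal_transpose, mul_diagonal, mul_diagonal, diagonal_mul]
    rcases k with k | k <;> rcases l with l | l <;> simp [formD, altForm, antidiag]
    split_ifs with h
    · rw [h, Fin.rev_rev]
    · rfl
  change c⁻¹ * polarPfaffian n (fun _ => formD n * _) = _
  rw [hform, polarPfaffian_congr_transform, det_diagonal, ← hc, Fintype.prod_sum_type]
  simp
  field_simp

end Pfaffian

/-! ### Weights and Weyl group symmetries in types C and D. -/

section Even

variable {n : ℕ}

/-- The diagonal entries `(x₁, …, xₙ, -xₙ, …, -x₁)`. -/
def weightsEven (x : Fin n → ℂ) : Fin n ⊕ Fin n → ℂ :=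
  Sum.elim x fun i => -x (Fin.rev i)

theorem diagonal_weightsEven_mem (x : Fin n → ℂ) : diagonal (weightsEven x) ∈ cartanEven n :=
  ⟨x, rfl⟩

theorem entriesEven_sub_inv (t : Fin n → ℂˣ) (k : Fin n ⊕ Fin n) :
    (entriesEven n t k - (entriesEven n t k)⁻¹) / 2 = weightsEven (halfDiff t) k := by
  rcases k with k | k
  · rfl
  · simp only [entriesEven, weightsEven, halfDiff, MonoidHom.coe_mk, OneHom.coe_mk, Sum.elim_inr,
      inv_inv]
    ring

theorem weightsEven_eq_eval (x : Fin n → ℂ) (k : Fin n ⊕ Fin n) :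
    weightsEven x k = MvPolynomial.eval x
      (Sum.elim MvPolynomial.X (fun i => -MvPolynomial.X (Fin.rev i)) k) := by
  rcases k with k | k <;> simp [weightsEven]

theorem sum_weightsEven_pow (x : Fin n → ℂ) (k : ℕ) :
    ∑ i, weightsEven x i ^ (2 * k) = 2 * ∑ i, x i ^ (2 * k) := by
  rw [Fintype.sum_sum_type, two_mul (∑ i, x i ^ (2 * k)),
    ← Equiv.sum_comp Fin.revPerm (fun i => x i ^ (2 * k))]
  simp [weightsEven, pow_mul,
    ← Equiv.sum_comp Fin.revPerm (fun i => (x i ^ 2) ^ k)]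

theorem antidiag_perm (τ : Equiv.Perm (Fin n)) (i j : Fin n) :
    antidiag n (τ i) (Fin.rev (τ (Fin.rev j))) = antidiag n i j := by
  simp [antidiag, Fin.rev_eq_iff]

theorem antidiag_perm' (τ : Equiv.Perm (Fin n)) (i j : Fin n) :
    antidiag n (Fin.rev (τ (Fin.rev i))) (τ j) = antidiag n i j := by
  simp [antidiag]

theorem isMonomialSymmetry_perm_even {E : Matrix (Fin n ⊕ Fin n) (Fin n ⊕ Fin n) ℂ}
    (hE : E = formC n ∨ E = formD n) (σ : Equiv.Perm (Fin n)) :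
    IsMonomialSymmetry E (entriesEven n) weightsEven (fun x i => x (σ i)) := by
  refine ⟨Equiv.Perm.sumCongr σ.symm (Fin.revPerm.trans (σ.symm.trans Fin.revPerm)), 1,
    Equiv.arrowCongr σ.symm (Equiv.refl _), ?_, ?_, ?_, ?_⟩
  · rw [Equiv.Perm.sign_sumCongr, sign_revPerm_conj, ← sq, Int.units_sq]
    simp
  · rcases hE with rfl | rfl <;> rintro (k | k) (l | l) <;>
      simp [formC, formD, antidiag_perm, antidiag_perm']
  · rintro t (k | k) <;> simp [entriesEven]
  · rintro x (k | k) <;> simp [weightsEven]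

/-- The exchange of the indices of `xᵢ` and `-xᵢ`. -/
def flipEven (i : Fin n) : Equiv.Perm (Fin n ⊕ Fin n) :=
  Equiv.swap (Sum.inl i) (Sum.inr (Fin.rev i))

theorem flipEven_inl (i a : Fin n) :
    flipEven i (Sum.inl a) = if a = i then Sum.inr (Fin.rev a) else Sum.inl a := by
  split_ifs with h
  · rw [h, flipEven, Equiv.swap_apply_left]
  · exact Equiv.swap_apply_of_ne_of_ne (by simpa using h) (by simp)

theorem flipEven_inr (i a : Fin n) :
    flipEven i (Sum.inr a) = if Fin.rev a = i then Sum.inl (Fin.rev a) else Sum.inr a := by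
  split_ifs with h
  · rw [← h, flipEven, Fin.rev_rev, Equiv.swap_apply_right]
  · refine Equiv.swap_apply_of_ne_of_ne (by simp) ?_
    rintro h2
    rw [Sum.inr.inj h2, Fin.rev_rev] at h
    exact h rfl

/-- The inversion of one coordinate of the torus. -/
def invertAt (i : Fin n) : Equiv.Perm (Fin n → ℂˣ) :=
  Function.Involutive.toPerm (fun t k => if k = i then (t k)⁻¹ else t k) fun t => by
    funext k
    by_cases h : k = i <;> simp [h]

theorem invertAt_apply (i : Fin n) (t : Fin n → ℂˣ) (k : Fin n) :
    invertAt i t k = if k = i then (t k)⁻¹ else t k := rfl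

theorem entriesEven_flip (i : Fin n) (t : Fin n → ℂˣ) (k : Fin n ⊕ Fin n) :
    entriesEven n (invertAt i t) (flipEven i k) = entriesEven n t k := by
  rcases k with k | k
  · by_cases h : k = i <;> simp [entriesEven, flipEven_inl, invertAt_apply, h]
  · by_cases h : Fin.rev k = i <;> simp [entriesEven, flipEven_inr, invertAt_apply, h]

theorem weightsEven_flip (i : Fin n) (x : Fin n → ℂ) (k : Fin n ⊕ Fin n) :
    weightsEven (fun k => (if k = i then -1 else 1) * x k) (flipEven i k) = weightsEven x k := by
  rcases k with k | k
  · by_cases h : k = i <;> simp [weightsEven, flipEven_inl, h]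
  · by_cases h : Fin.rev k = i <;> simp [weightsEven, flipEven_inr, h]

theorem formD_flip (i : Fin n) (k l : Fin n ⊕ Fin n) :
    formD n (flipEven i k) (flipEven i l) = formD n k l := by
  rcases k with k | k <;> rcases l with l | l
  · rw [flipEven_inl, flipEven_inl]
    split_ifs <;> simp [formD, antidiag] <;> grind
  · rw [flipEven_inl, flipEven_inr]
    split_ifs <;> simp [formD, antidiag] <;> grind [Fin.rev_rev]
  · rw [flipEven_inr, flipEven_inl]
    split_ifs <;> simp [formD, antidiag] <;> grind [Fin.rev_rev]
  · rw [flipEven_inr, flipEven_inr]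
    split_ifs <;> simp [formD, antidiag] <;> grind [Fin.rev_rev]

/-- A single exchange preserves the form but is an odd permutation; two of them together have
determinant 1. -/
theorem isMonomialSymmetry_sign_D (i j : Fin n) (hij : i ≠ j) :
    IsMonomialSymmetry (formD n) (entriesEven n) weightsEven
      (fun x k => (if k = i ∨ k = j then -1 else 1) * x k) := by
  refine ⟨flipEven i * flipEven j, 1, invertAt i * invertAt j, ?_, fun k l => ?_, fun t k => ?_,
    fun x k => ?_⟩
  · rw [Equiv.Perm.sign_mul, flipEven, flipEven, Equiv.Perm.sign_swap (by simp),
      Equiv.Perm.sign_swap (by simp)]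
    simp
  · simp [formD_flip]
  · simp [entriesEven_flip]
  · have h : (fun k => (if k = i ∨ k = j then -1 else 1) * x k) =
        fun k => (if k = i then -1 else 1) * ((if k = j then -1 else 1) * x k) := by
      funext k
      grind
    beta_reduce
    rw [h, Equiv.Perm.mul_apply, weightsEven_flip i (fun k => (if k = j then -1 else 1) * x k),
      weightsEven_flip]

/-- The one entry `-1` corrects both the determinant of the exchange and the sign by which it
changes the alternating form. -/
theorem isMonomialSymmetry_sign_C (i : Fin n) :
    IsMonomialSymmetry (formC n) (entriesEven n) weightsEven
      (fun x k => (if k = i then -1 else 1) * x k) := by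
  refine ⟨flipEven i, fun k => if k = Sum.inl i then -1 else 1, invertAt i, ?_, fun k l => ?_,
    entriesEven_flip i, weightsEven_flip i⟩
  · rw [flipEven, Equiv.Perm.sign_swap (by simp), Finset.prod_ite_eq']
    simp
  · rcases k with k | k <;> rcases l with l | l
    · rw [flipEven_inl, flipEven_inl]
      split_ifs <;> simp [formC, antidiag] <;> grind
    · rw [flipEven_inl, flipEven_inr]
      split_ifs <;> simp [formC, antidiag] <;> grind [Fin.rev_rev]
    · rw [flipEven_inr, flipEven_inl]
      split_ifs <;> simp [formC, antidiag] <;> grind [Fin.rev_rev]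
    · rw [flipEven_inr, flipEven_inr]
      split_ifs <;> simp [formC, antidiag] <;> grind [Fin.rev_rev]

end Even

/-! ### Weights and Weyl group symmetries in type B. -/

section Odd

variable {n : ℕ}

/-- The diagonal entries `(x₁, …, xₙ, 0, -xₙ, …, -x₁)`. -/
def weightsOdd (x : Fin n → ℂ) : Fin n ⊕ (Unit ⊕ Fin n) → ℂ :=
  Sum.elim x (Sum.elim (fun _ => 0) fun i => -x (Fin.rev i))

theorem diagonal_weightsOdd_mem (x : Fin n → ℂ) : diagonal (weightsOdd x) ∈ cartanOdd n :=
  ⟨x, rfl⟩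

theorem entriesOdd_sub_inv (t : Fin n → ℂˣ) (k : Fin n ⊕ (Unit ⊕ Fin n)) :
    (entriesOdd n t k - (entriesOdd n t k)⁻¹) / 2 = weightsOdd (halfDiff t) k := by
  rcases k with k | k | k
  · rfl
  · simp [entriesOdd, weightsOdd]
  · simp only [entriesOdd, weightsOdd, halfDiff, MonoidHom.coe_mk, OneHom.coe_mk, Sum.elim_inr,
      inv_inv]
    ring

theorem weightsOdd_eq_eval (x : Fin n → ℂ) (k : Fin n ⊕ (Unit ⊕ Fin n)) :
    weightsOdd x k = MvPolynomial.eval x (Sum.elim MvPolynomial.X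
      (Sum.elim (fun _ => 0) fun i => -MvPolynomial.X (Fin.rev i)) k) := by
  rcases k with k | k | k <;> simp [weightsOdd]

/-- Positivity of `k` matters: the zero weight would contribute `0 ^ 0 = 1`. -/
theorem sum_weightsOdd_pow (x : Fin n → ℂ) (k : ℕ) (hk : 0 < k) :
    ∑ i, weightsOdd x i ^ (2 * k) = 2 * ∑ i, x i ^ (2 * k) := by
  rw [← sum_weightsEven_pow, Fintype.sum_sum_type, Fintype.sum_sum_type, Fintype.sum_sum_type]
  simp [weightsOdd, weightsEven, hk.ne']

theorem isMonomialSymmetry_perm_odd (σ : Equiv.Perm (Fin n)) :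
    IsMonomialSymmetry (formB n) (entriesOdd n) weightsOdd (fun x i => x (σ i)) := by
  refine ⟨Equiv.Perm.sumCongr σ.symm
    (Equiv.Perm.sumCongr 1 (Fin.revPerm.trans (σ.symm.trans Fin.revPerm))), 1,
    Equiv.arrowCongr σ.symm (Equiv.refl _), ?_, ?_, ?_, ?_⟩
  · rw [Equiv.Perm.sign_sumCongr, Equiv.Perm.sign_sumCongr, sign_revPerm_conj, Equiv.Perm.sign_one,
      one_mul, ← sq, Int.units_sq]
    simp
  · rintro (k | k | k) (l | l | l) <;> simp [formB, antidiag_perm, antidiag_perm']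
  · rintro t (k | k | k) <;> simp [entriesOdd]
  · rintro x (k | k | k) <;> simp [weightsOdd]

/-- The entry `-1` in the middle corrects the determinant of the exchange; the form sees it only
squared. -/
theorem isMonomialSymmetry_sign_B (i : Fin n) :
    IsMonomialSymmetry (formB n) (entriesOdd n) weightsOdd
      (fun x k => (if k = i then -1 else 1) * x k) := by
  have hl : ∀ a : Fin n, Equiv.swap (Sum.inl i) (Sum.inr (Sum.inr (Fin.rev i))) (Sum.inl a) =
      (if a = i then Sum.inr (Sum.inr (Fin.rev a)) else Sum.inl a :
        Fin n ⊕ (Unit ⊕ Fin n)) := by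
    intro a
    split_ifs with h
    · rw [h, Equiv.swap_apply_left]
    · exact Equiv.swap_apply_of_ne_of_ne (by simpa using h) (by simp)
  have hm : ∀ a : Unit, Equiv.swap (Sum.inl i) (Sum.inr (Sum.inr (Fin.rev i))) (Sum.inr (Sum.inl a)) =
      (Sum.inr (Sum.inl a) : Fin n ⊕ (Unit ⊕ Fin n)) := fun a =>
    Equiv.swap_apply_of_ne_of_ne (by simp) (by simp)
  have hr : ∀ a : Fin n, Equiv.swap (Sum.inl i) (Sum.inr (Sum.inr (Fin.rev i)))
      (Sum.inr (Sum.inr a)) = (if Fin.rev a = i then Sum.inl (Fin.rev a) else Sum.inr (Sum.inr a) :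
        Fin n ⊕ (Unit ⊕ Fin n)) := by
    intro a
    split_ifs with h
    · rw [← h, Fin.rev_rev, Equiv.swap_apply_right]
    · refine Equiv.swap_apply_of_ne_of_ne (by simp) ?_
      rintro h2
      rw [Sum.inr.inj (Sum.inr.inj h2), Fin.rev_rev] at h
      exact h rfl
  refine ⟨Equiv.swap (Sum.inl i) (Sum.inr (Sum.inr (Fin.rev i))),
    fun k => if k = Sum.inr (Sum.inl ()) then -1 else 1, invertAt i, ?_, fun k l => ?_,
    fun t k => ?_, fun x k => ?_⟩
  · rw [Equiv.Perm.sign_swap (by simp), Finset.prod_ite_eq']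
    simp
  · rcases k with k | k | k <;> rcases l with l | l | l <;> simp only [hl, hm, hr] <;>
      split_ifs <;> simp [formB, antidiag] <;> grind [Fin.rev_rev]
  · rcases k with k | k | k
    · by_cases h : k = i <;> simp [entriesOdd, hl, invertAt_apply, h]
    · simp [entriesOdd, hm]
    · by_cases h : Fin.rev k = i <;> simp [entriesOdd, hr, invertAt_apply, h]
  · rcases k with k | k | k
    · by_cases h : k = i <;> simp [weightsOdd, hl, h]
    · simp [weightsOdd, hm]
    · by_cases h : Fin.rev k = i <;> simp [weightsOdd, hr, h]

end Odd

/-! ### The characterizations. -/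

section Main

variable {ι : Type} [Fintype ι] [DecidableEq ι] {E : Matrix ι ι ℂ} {n : ℕ}
  {d : (Fin n → ℂˣ) →* (ι → ℂ)} (hdet : ∀ t, ∏ i, d t i = 1)
  (hdE : ∀ t i j, d t i * E i j * d t j = E i j)

/-- An invariant function gives an element of the polynomial representation ring. -/
theorem mem_repPoly_of_invariant (hE : IsForm E) (𝔱 : Submodule ℂ (Matrix ι ι ℂ))
    {δ : (Fin n → ℂ) → ι → ℂ} (hδ : ∀ t i, (d t i - (d t i)⁻¹) / 2 = δ (halfDiff t) i)
    {f : (diagHom E d hdet hdE).range → ℂ} {F : Matrix ι ι ℂ → ℂ} (hF : F ∈ invariantAlg E)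
    (hf : ∀ t, f ((diagHom E d hdet hdE).rangeRestrict t) = F (diagonal (δ (halfDiff t)))) :
    f ∈ repPoly hE (diagHom E d hdet hdE).range 𝔱 := by
  refine mem_repPoly_of_mem_invariantAlg hE 𝔱 hF ?_
  rintro ⟨_, t, rfl⟩
  rw [springer_diagHom hdet hdE hE hδ]
  exact hf t

/-- The characterization for root systems whose Weyl group contains all sign changes. -/
theorem mem_repPoly_iff_of_sign (hE : IsForm E) {𝔱 : Submodule ℂ (Matrix ι ι ℂ)}
    {δ : (Fin n → ℂ) → ι → ℂ} (D : ι → MvPolynomial (Fin n) ℂ)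
    (hD : ∀ x i, δ x i = MvPolynomial.eval x (D i)) (h𝔱 : ∀ x, diagonal (δ x) ∈ 𝔱)
    (hδ : ∀ t i, (d t i - (d t i)⁻¹) / 2 = δ (halfDiff t) i)
    (hpow : ∀ x k, 0 < k → ∑ i, δ x i ^ (2 * k) = 2 * ∑ i, x i ^ (2 * k))
    (hperm : ∀ σ : Equiv.Perm (Fin n), IsMonomialSymmetry E d δ (fun x i => x (σ i)))
    (hsign : ∀ i, IsMonomialSymmetry E d δ (fun x k => (if k = i then -1 else 1) * x k))
    (f : (diagHom E d hdet hdE).range → ℂ) :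
    f ∈ repPoly hE (diagHom E d hdet hdE).range 𝔱 ↔
      ∃ P : MvPolynomial (Fin n) ℂ, P.IsSymmetric ∧
        ∀ t : Fin n → ℂˣ, f ((diagHom E d hdet hdE).rangeRestrict t) =
          MvPolynomial.eval (fun i => halfDiff t i ^ 2) P := by
  constructor
  · intro hf
    obtain ⟨q, hfq, hq⟩ := exists_polynomial_of_mem_repPoly hdet hdE hE D hD h𝔱 hδ hf
    obtain ⟨P, hP⟩ := eval_eq_of_sign_invariant fun i x => hq _ (hsign i) x
    refine ⟨symmetrize P, isSymmetric_symmetrize P, fun t => ?_⟩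
    -- Without an odd part, the type D averaging applies with `Q = 0`.
    have h := eval_eq_eval_symmetrize (P := P) (Q := 0) (fun σ x => hq _ (hperm σ) x)
      (fun x => by rw [hP, map_zero, mul_zero, add_zero]) (halfDiff t)
    rw [hfq, h]
    simp [symmetrize]
  · rintro ⟨P, hP, hfP⟩
    obtain ⟨F, hF, hFP⟩ := exists_invariant_of_isSymmetric E δ hpow hP
    exact mem_repPoly_of_invariant hdet hdE hE 𝔱 hδ hF fun t => by rw [hfP, hFP]

theorem mem_repPoly_D_iff (f : (torusD n).range → ℂ) :
    f ∈ repPoly (isForm_formD n) (torusD n).range (cartanEven n) ↔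
      ∃ P Q : MvPolynomial (Fin n) ℂ, P.IsSymmetric ∧ Q.IsSymmetric ∧
        ∀ t : Fin n → ℂˣ, f ((torusD n).rangeRestrict t) =
          MvPolynomial.eval (fun i => halfDiff t i ^ 2) P +
            (∏ i, halfDiff t i) * MvPolynomial.eval (fun i => halfDiff t i ^ 2) Q := by
  constructor
  · intro hf
    obtain ⟨q, hfq, hq⟩ := exists_polynomial_of_mem_repPoly _ _ (isForm_formD n) _
      weightsEven_eq_eval diagonal_weightsEven_mem entriesEven_sub_inv hf
    obtain ⟨P, Q, hPQ⟩ := eval_eq_of_even_sign_invariant fun i j hij x =>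
      hq _ (isMonomialSymmetry_sign_D i j hij) x
    refine ⟨symmetrize P, symmetrize Q, isSymmetric_symmetrize P, isSymmetric_symmetrize Q,
      fun t => (hfq t).trans ?_⟩
    exact eval_eq_eval_symmetrize
      (fun σ x => hq _ (isMonomialSymmetry_perm_even (Or.inr rfl) σ) x) hPQ _
  · rintro ⟨P, Q, hP, hQ, hf⟩
    obtain ⟨F, hF, hFP⟩ := exists_invariant_of_isSymmetric (formD n) weightsEven
      (fun x k _ => sum_weightsEven_pow x k) hP
    obtain ⟨F', hF', hFQ⟩ := exists_invariant_of_isSymmetric (formD n) weightsEven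
      (fun x k _ => sum_weightsEven_pow x k) hQ
    obtain ⟨K, hK, hKprod⟩ := exists_invariant_eq_prod n
    -- The invariant extension is `F + K * F'`, with `K` the normalized Pfaffian.
    refine mem_repPoly_of_invariant _ _ (isForm_formD n) _ entriesEven_sub_inv
      (Subalgebra.add_mem _ hF (Subalgebra.mul_mem _ hK hF')) fun t => (hf t).trans ?_
    rw [Pi.add_apply, Pi.mul_apply, hFP, hFQ]
    congr 2
    exact (hKprod (halfDiff t)).symm

end Main

end

end ClassicalSpringer

theorem proposition6p3 (n : ℕ) :
    -- the symplectic group of size 2n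
    (∀ f : (ClassicalSpringer.torusC n).range → ℂ,
      ClassicalSpringer.IsRegular (fun t => ClassicalSpringer.toMat t.1) f →
      (f ∈ ClassicalSpringer.repPoly (ClassicalSpringer.isForm_formC n)
          (ClassicalSpringer.torusC n).range (ClassicalSpringer.cartanEven n) ↔
        ∃ P : MvPolynomial (Fin n) ℂ, P.IsSymmetric ∧
          ∀ t : Fin n → ℂˣ, f ((ClassicalSpringer.torusC n).rangeRestrict t) =
            MvPolynomial.eval (fun i => ClassicalSpringer.halfDiff t i ^ 2) P)) ∧
    -- the special orthogonal group of size 2n + 1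
    (∀ f : (ClassicalSpringer.torusB n).range → ℂ,
      ClassicalSpringer.IsRegular (fun t => ClassicalSpringer.toMat t.1) f →
      (f ∈ ClassicalSpringer.repPoly (ClassicalSpringer.isForm_formB n)
          (ClassicalSpringer.torusB n).range (ClassicalSpringer.cartanOdd n) ↔
        ∃ P : MvPolynomial (Fin n) ℂ, P.IsSymmetric ∧
          ∀ t : Fin n → ℂˣ, f ((ClassicalSpringer.torusB n).rangeRestrict t) =
            MvPolynomial.eval (fun i => ClassicalSpringer.halfDiff t i ^ 2) P)) ∧
    -- the special orthogonal group of size 2n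
    (∀ f : (ClassicalSpringer.torusD n).range → ℂ,
      ClassicalSpringer.IsRegular (fun t => ClassicalSpringer.toMat t.1) f →
      (f ∈ ClassicalSpringer.repPoly (ClassicalSpringer.isForm_formD n)
          (ClassicalSpringer.torusD n).range (ClassicalSpringer.cartanEven n) ↔
        ∃ P Q : MvPolynomial (Fin n) ℂ, P.IsSymmetric ∧ Q.IsSymmetric ∧
          ∀ t : Fin n → ℂˣ, f ((ClassicalSpringer.torusD n).rangeRestrict t) =
            MvPolynomial.eval (fun i => ClassicalSpringer.halfDiff t i ^ 2) P +
              (∏ i, ClassicalSpringer.halfDiff t i) *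
                MvPolynomial.eval (fun i => ClassicalSpringer.halfDiff t i ^ 2) Q)) := by
  refine ⟨fun f _ => ?_, fun f _ => ?_, fun f _ => ClassicalSpringer.mem_repPoly_D_iff f⟩
  · exact ClassicalSpringer.mem_repPoly_iff_of_sign _ _ _ _
      ClassicalSpringer.weightsEven_eq_eval ClassicalSpringer.diagonal_weightsEven_mem
      ClassicalSpringer.entriesEven_sub_inv
      (fun x k _ => ClassicalSpringer.sum_weightsEven_pow x k)
      (ClassicalSpringer.isMonomialSymmetry_perm_even (Or.inl rfl))
      ClassicalSpringer.isMonomialSymmetry_sign_C f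
  · exact ClassicalSpringer.mem_repPoly_iff_of_sign _ _ _ _
      ClassicalSpringer.weightsOdd_eq_eval ClassicalSpringer.diagonal_weightsOdd_mem
      ClassicalSpringer.entriesOdd_sub_inv ClassicalSpringer.sum_weightsOdd_pow
      ClassicalSpringer.isMonomialSymmetry_perm_odd
      ClassicalSpringer.isMonomialSymmetry_sign_B f
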